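/- Write $\mathbb N=\{1,2,\dots\}$. Let $d>1$ and let $\{f_i\}_{i\ge1}$ be a $d$-decaying Gauss like iterated function system, i.e. a sequence of $C^1$ maps $f_i:[0,1]\to[0,1]$ such that 1. $f_i((0,1))\cap f_j((0,1))=\emptyset$ for $i\ne j$; 2. there are $k\in\mathbb N$ and $0<\rho<1$ with $0<|(f_{a_1}\circ\cdots\circ f_{a_k})'(x)|\le\rho$ for all $(a_1,\dots,a_k)\in\mathbb N^k$ and $x\in[0,1]$; 3. for every $\varepsilon>0$ there are $C_1,C_2>0$ such that for every $i\in\mathbb N$ there are constants $\xi_i,\lambda_i$ with $\xi_i\le|f_i'(x)|\le\lambda_i$ for all $x\in[0,1]$ and $C_1i^{-(d+\varepsilon)}\le\xi_i\le\lambda_i\le C_2i^{-(d-\varepsilon)}$; 4. $\bigcup_{i\ge1}f_i([0,1])=(0,1]$, and $f_i(x)<f_j(x)$ for all $x\in[0,1]$ whenever $i>j$; 5. there is $\kappa\ge1$ such that $|(f_{a_1}\circ\cdots\circ f_{a_n})'(x)|\le\kappa\,|(f_{a_1}\circ\cdots\circ f_{a_n})'(y)|$ for all $n\in\mathbb N$,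 $(a_1,\dots,a_n)\in\mathbb N^n$ and $x,y\in[0,1]$. If there is exactly one sequence $(a_n)_{n\ge1}$ in $\mathbb N$ with $x=\lim_{n\to\infty}f_{a_1}\circ\cdots\circ f_{a_n}(1)$, write $a_n(x)=a_n$ and call these the digits of $x$ (only countably many points of $(0,1)$ have no or more than one such sequence). Let $\Lambda$ be the set of $x\in(0,1)$ that have digits in this sense and satisfy $a_n(x)\le a_{n+1}(x)$ for all $n\ge1$. Let $m\ge1$ and let $t_0,\dots,t_m\ge0$ be real numbers with $t_0\ne0$ and $t_i\neq0$ for at least one $1\le i\le m$, and put $\Sigma_t=\sum_{i=0}^m t_i$. For $0\le\alpha\le\infty$ let $$E(\Lambda,\alpha,\{t_i\}_{0\le i\le m})=\Big\{x\in\Lambda:\ \liminf_{n\to\infty}\frac{\log\big(a_n^{t_0}(x)\cdots a_{n+m}^{t_m}(x)\big)}{\log n}=\alpha\Big\}.$$ **Theorem 1.4.** For any $0\le\alpha\le\infty$, $$\dim_{\rm H}E(\Lambda,\alpha,\{t_i\}_{0\le i\le m})=\begin{cases}0,&0\le\alpha<\Sigma_t,\\[2pt] \dfrac{\alpha-\Sigma_t}{d\alpha},&\Sigma_t\le\alpha<\infty,\\[6pt]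 \dfrac1d,&\alpha=\infty.\end{cases}$$ -/

import Mathlib

open Set Filter Topology

noncomputable section

namespace GaussLike

/-- The composition `f_{w_1} ∘ ⋯ ∘ f_{w_n}` along a finite word `w = [w_1, …, w_n]` of positive
integers (the identity for the empty word). -/
def wordMap (f : ℕ+ → ℝ → ℝ) : List ℕ+ → ℝ → ℝ
  | [] => id
  | i :: w => f i ∘ wordMap f w

/-- `f = (f_i)_{i ≥ 1}` is a `d`-decaying Gauss like iterated function system on `[0, 1]`.
Only the restrictions of the `f_i` to `[0, 1]` matter; derivatives are those of the restrictions
(one-sided at the endpoints). -/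
structure IsDecayingGaussLike (d : ℝ) (f : ℕ+ → ℝ → ℝ) : Prop where
  one_lt : 1 < d
  mapsTo : ∀ i, MapsTo (f i) (Icc 0 1) (Icc 0 1)
  contDiffOn : ∀ i, ContDiffOn ℝ 1 (f i) (Icc 0 1)
  /-- Open set condition. -/
  openSet : ∀ i j, i ≠ j → Disjoint (f i '' Ioo 0 1) (f j '' Ioo 0 1)
  /-- Contraction property. -/
  contraction : ∃ m : ℕ, ∃ ρ : ℝ, 0 < ρ ∧ ρ < 1 ∧
    ∀ w : List ℕ+, w.length = m → ∀ x ∈ Icc (0 : ℝ) 1,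
      0 < |derivWithin (wordMap f w) (Icc 0 1) x| ∧
        |derivWithin (wordMap f w) (Icc 0 1) x| ≤ ρ
  /-- Regular property. -/
  regular : ∀ ε : ℝ, 0 < ε → ∃ C₁ C₂ : ℝ, 0 < C₁ ∧ 0 < C₂ ∧
    ∀ i : ℕ+, ∃ ξ l : ℝ,
      (∀ x ∈ Icc (0 : ℝ) 1,
        ξ ≤ |derivWithin (f i) (Icc 0 1) x| ∧ |derivWithin (f i) (Icc 0 1) x| ≤ l) ∧
      C₁ / (i : ℝ) ^ (d + ε) ≤ ξ ∧ ξ ≤ l ∧ l ≤ C₂ / (i : ℝ) ^ (d - ε)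
  /-- The images cover the unit interval. The point `0` is left out: by `lt_of_lt` it cannot lie
  in any image, since `f_i x = 0` would force `f_{i+1} x < 0`. -/
  iUnion_image : ⋃ i, f i '' Icc 0 1 = Ioc 0 1
  lt_of_lt : ∀ i j : ℕ+, j < i → ∀ x ∈ Icc (0 : ℝ) 1, f i x < f j x
  /-- Bounded distortion property. -/
  distortion : ∃ κ : ℝ, 1 ≤ κ ∧ ∀ w : List ℕ+, ∀ x ∈ Icc (0 : ℝ) 1, ∀ y ∈ Icc (0 : ℝ) 1,
    |derivWithin (wordMap f w) (Icc 0 1) x| ≤ κ * |derivWithin (wordMap f w) (Icc 0 1) y|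

/-- `x = lim_n f_{a_1} ∘ ⋯ ∘ f_{a_n} (1)`. Sequences are indexed from `0`, so that `a k` is the
digit `a_{k+1}`. -/
def IsCoding (f : ℕ+ → ℝ → ℝ) (a : ℕ → ℕ+) (x : ℝ) : Prop :=
  Tendsto (fun n : ℕ => wordMap f ((List.range n).map a) 1) atTop (𝓝 x)

/-- `a` is the digit sequence of `x`: it codes `x`, and no other sequence does. -/
def IsDigitSeq (f : ℕ+ → ℝ → ℝ) (a : ℕ → ℕ+) (x : ℝ) : Prop :=
  IsCoding f a x ∧ ∀ b : ℕ → ℕ+, IsCoding f b x → b = a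

/-- `liminf_n log (a_n ^ t_0 ⋯ a_{n+m} ^ t_m) / log n`, as an extended real number. With digits
indexed from `0`, the index `k` below stands for `n = k + 1`. -/
def lowerRate {m : ℕ} (t : Fin (m + 1) → ℝ) (a : ℕ → ℕ+) : EReal :=
  liminf (fun k : ℕ =>
    ((Real.log (∏ i : Fin (m + 1), ((a (k + (i : ℕ)) : ℕ) : ℝ) ^ t i) /
      Real.log ((k : ℝ) + 1) : ℝ) : EReal)) atTop

/-- The points of `(0, 1)` whose digits are non-decreasing. -/
def Lam (f : ℕ+ → ℝ → ℝ) : Set ℝ :=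
  {x | x ∈ Ioo 0 1 ∧ ∃ a, IsDigitSeq f a x ∧ ∀ n, a n ≤ a (n + 1)}

/-- The level set `E(Λ, α, {t_i})`, for `α` an extended real number. -/
def levelSet (f : ℕ+ → ℝ → ℝ) {m : ℕ} (t : Fin (m + 1) → ℝ) (α : EReal) : Set ℝ :=
  {x | x ∈ Lam f ∧ ∃ a, IsDigitSeq f a x ∧ lowerRate t a = α}

end GaussLike

end

noncomputable section

namespace GaussLike

variable {d : ℝ} {f : ℕ+ → ℝ → ℝ}

/-! Write `T = ∑ i, t i`; words below are finite digit strings and the cylinder of a word is the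
image of `[0, 1]` under its `wordMap`.

Upper bound. As digits are non-decreasing, the logarithm in `lowerRate` is at least `T log a_k`, so
a lower rate below `x` forces `a_k ≤ (k+1)^(x/T)` infinitely often. Each such `k` puts the point in
the cylinder of a non-decreasing word of length `n = k+1` with all letters at most `n^(x/T)`. Its
diameter is at most a constant times a product of letter weights `u j ≤ C j^(-D)`, with `D < d` at
will and all weights below some `q < 1` (`exists_weights`). A non-decreasing word is a multiset of
letters, so an Euler product bounds the sum of the `s`-th powers over words of length `n`. Keeping a
factor `r^n` with `r > 1` inside the product, one gets `r^(-n) exp(c n^β)` with `β < 1`, provided `s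
d > 1 - e` for some `0 < e < T/x`. This is summable in `n`, so the `s`-dimensional Hausdorff measure
is finite (`dimH_le_of_frequently`). Letting `x` decrease to `α` gives the bound, which is zero for
`α < T`; taking `e = 0`, which imposes no bound on the letters, gives `1/d` on all of `Lam f`.

Lower bound. Let the `k`-th digit run over `q k` alternate integers from `B k`, successive blocks
being ordered. Cantor series digits in bases `q k` parametrise these points by `[0, 1)`, and the
inverse map is `s`-Hölder when the `(D s)`-th power of the top of block `k+1` is `o(q k)`, for some
`D > d` (`le_dimH_of_digit_blocks`). Blocks at height `k^γ` of size `k^(γ-1)`, with `γ = α/T`, allow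
every `s < (α-T)/(dα)`; geometric blocks have infinite rate and allow every `s < 1/d`. -/

theorem wordMap_append (f : ℕ+ → ℝ → ℝ) (u v : List ℕ+) :
    wordMap f (u ++ v) = wordMap f u ∘ wordMap f v := by
  induction u with
  | nil => rfl
  | cons i u ih => simp only [List.cons_append, wordMap, ih, Function.comp_assoc]

/-! ### Mean value estimates and contraction along words. -/

theorem abs_sub_le_of_abs_derivWithin_le {g : ℝ → ℝ} {c : ℝ}
    (hg : DifferentiableOn ℝ g (Icc 0 1))
    (hc : ∀ x ∈ Icc (0 : ℝ) 1, |derivWithin g (Icc 0 1) x| ≤ c) :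
    ∀ x ∈ Icc (0 : ℝ) 1, ∀ y ∈ Icc (0 : ℝ) 1, |g x - g y| ≤ c * |x - y| := by
  intro x hx y hy
  exact (convex_Icc (0 : ℝ) 1).norm_image_sub_le_of_norm_derivWithin_le hg hc hy hx

theorem le_abs_sub_of_le_abs_derivWithin {g : ℝ → ℝ} {c : ℝ}
    (hg : DifferentiableOn ℝ g (Icc 0 1))
    (hc : ∀ x ∈ Icc (0 : ℝ) 1, c ≤ |derivWithin g (Icc 0 1) x|) :
    ∀ x ∈ Icc (0 : ℝ) 1, ∀ y ∈ Icc (0 : ℝ) 1, c * |x - y| ≤ |g x - g y| := by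
  have key : ∀ x ∈ Icc (0 : ℝ) 1, ∀ y ∈ Icc (0 : ℝ) 1, x < y → c * |x - y| ≤ |g x - g y| := by
    intro x hx y hy hxy
    have hsub : Icc x y ⊆ Icc (0 : ℝ) 1 := Icc_subset_Icc hx.1 hy.2
    obtain ⟨z, hz, hz'⟩ := exists_deriv_eq_slope g hxy (hg.continuousOn.mono hsub)
      (hg.mono (Ioo_subset_Icc_self.trans hsub))
    have hz1 : z ∈ Ioo (0 : ℝ) 1 := ⟨hx.1.trans_lt hz.1, hz.2.trans_le hy.2⟩
    have h1 := hc z (Ioo_subset_Icc_self hz1)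
    rw [derivWithin_of_mem_nhds (Icc_mem_nhds hz1.1 hz1.2), hz', abs_div,
      le_div_iff₀ (abs_pos.2 (sub_pos.2 hxy).ne')] at h1
    rwa [abs_sub_comm x, abs_sub_comm (g x)]
  intro x hx y hy
  rcases lt_trichotomy x y with h | h | h
  · exact key x hx y hy h
  · simp [h]
  · rw [abs_sub_comm x, abs_sub_comm (g x)]
    exact key y hy x hx h

namespace IsDecayingGaussLike

theorem mapsTo_wordMap (hf : IsDecayingGaussLike d f) (w : List ℕ+) :
    MapsTo (wordMap f w) (Icc 0 1) (Icc 0 1) := by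
  induction w with
  | nil => exact mapsTo_id _
  | cons i w ih => exact (hf.mapsTo i).comp ih

theorem differentiableOn (hf : IsDecayingGaussLike d f) (i : ℕ+) :
    DifferentiableOn ℝ (f i) (Icc 0 1) :=
  (hf.contDiffOn i).differentiableOn one_ne_zero

theorem differentiableOn_wordMap (hf : IsDecayingGaussLike d f) (w : List ℕ+) :
    DifferentiableOn ℝ (wordMap f w) (Icc 0 1) := by
  induction w with
  | nil => exact differentiableOn_id
  | cons i w ih => exact (hf.differentiableOn i).comp ih (hf.mapsTo_wordMap w)

theorem exists_bilipschitz (hf : IsDecayingGaussLike d f) {ε : ℝ} (hε : 0 < ε) :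
    ∃ C₁ C₂ : ℝ, 0 < C₁ ∧ 0 < C₂ ∧ ∀ i : ℕ+, ∀ x ∈ Icc (0 : ℝ) 1, ∀ y ∈ Icc (0 : ℝ) 1,
      C₁ / (i : ℝ) ^ (d + ε) * |x - y| ≤ |f i x - f i y| ∧
        |f i x - f i y| ≤ C₂ / (i : ℝ) ^ (d - ε) * |x - y| := by
  obtain ⟨C₁, C₂, h1, h2, h⟩ := hf.regular ε hε
  refine ⟨C₁, C₂, h1, h2, fun i x hx y hy => ?_⟩
  obtain ⟨ξ, l, hd, hξ, -, hl⟩ := h i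
  exact ⟨le_abs_sub_of_le_abs_derivWithin (hf.differentiableOn i)
      (fun z hz => hξ.trans (hd z hz).1) x hx y hy,
    abs_sub_le_of_abs_derivWithin_le (hf.differentiableOn i)
      (fun z hz => (hd z hz).2.trans hl) x hx y hy⟩

theorem injOn (hf : IsDecayingGaussLike d f) (i : ℕ+) : InjOn (f i) (Icc 0 1) := by
  obtain ⟨C₁, C₂, h1, -, h⟩ := hf.exists_bilipschitz one_pos
  intro x hx y hy hxy
  have h3 := (h i x hx y hy).1
  have hi : (0 : ℝ) < i := by exact_mod_cast i.pos
  rw [hxy, sub_self, abs_zero] at h3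
  have h4 : 0 < C₁ / (i : ℝ) ^ (d + 1) := by positivity
  have h5 : |x - y| ≤ 0 := by
    by_contra! hlt
    exact absurd h3 (not_le.2 (mul_pos h4 hlt))
  exact sub_eq_zero.1 (abs_eq_zero.1 (le_antisymm h5 (abs_nonneg _)))

theorem injOn_wordMap (hf : IsDecayingGaussLike d f) (w : List ℕ+) :
    InjOn (wordMap f w) (Icc 0 1) := by
  induction w with
  | nil => exact injOn_id _
  | cons i w ih => exact (hf.injOn i).comp ih (hf.mapsTo_wordMap w)

theorem exists_lipschitz (hf : IsDecayingGaussLike d f) :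
    ∃ L : ℝ, 1 ≤ L ∧ ∀ i : ℕ+, ∀ x ∈ Icc (0 : ℝ) 1, ∀ y ∈ Icc (0 : ℝ) 1,
      |f i x - f i y| ≤ L * |x - y| := by
  have hd := hf.one_lt
  -- With `ε = d` the exponent `d - ε` vanishes, so the bound is uniform in the letter.
  obtain ⟨C₁, C₂, -, h2, h⟩ := hf.exists_bilipschitz (ε := d) (by linarith)
  refine ⟨max 1 C₂, le_max_left _ _, fun i x hx y hy => (h i x hx y hy).2.trans ?_⟩
  rw [sub_self, Real.rpow_zero, div_one]
  gcongr
  exact le_max_right _ _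

/-- Composition along words contracts exponentially in the length of the word. -/
theorem exists_contraction_rate (hf : IsDecayingGaussLike d f) :
    ∃ K θ : ℝ, 0 < K ∧ 0 < θ ∧ θ < 1 ∧ ∀ w : List ℕ+, ∀ x ∈ Icc (0 : ℝ) 1,
      ∀ y ∈ Icc (0 : ℝ) 1, |wordMap f w x - wordMap f w y| ≤ K * θ ^ w.length * |x - y| := by
  obtain ⟨k, ρ, hρ0, hρ1, hk⟩ := hf.contraction
  obtain ⟨L, hL1, hL⟩ := hf.exists_lipschitz
  have hL0 : 0 < L := by linarith
  -- The empty word has derivative `1 > ρ`.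
  have hk0 : k ≠ 0 := by
    rintro rfl
    have h := (hk [] rfl (1 / 2) (by norm_num)).2
    have h2 : derivWithin (wordMap f []) (Icc 0 1) (1 / 2) = 1 :=
      derivWithin_id _ _ (uniqueDiffOn_Icc one_pos _ (by norm_num))
    rw [h2, abs_one] at h
    linarith
  have hcon : ∀ w : List ℕ+, w.length = k → ∀ x ∈ Icc (0 : ℝ) 1, ∀ y ∈ Icc (0 : ℝ) 1,
      |wordMap f w x - wordMap f w y| ≤ ρ * |x - y| := fun w hw =>
    abs_sub_le_of_abs_derivWithin_le (hf.differentiableOn_wordMap w) fun z hz => (hk w hw z hz).2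
  have hlip : ∀ w : List ℕ+, ∀ x ∈ Icc (0 : ℝ) 1, ∀ y ∈ Icc (0 : ℝ) 1,
      |wordMap f w x - wordMap f w y| ≤ L ^ w.length * |x - y| := by
    intro w
    induction w with
    | nil => intro x _ y _; simp [wordMap]
    | cons i w ih =>
      intro x hx y hy
      refine (hL i _ (hf.mapsTo_wordMap w hx) _ (hf.mapsTo_wordMap w hy)).trans ?_
      rw [List.length_cons, pow_succ', mul_assoc]
      exact mul_le_mul_of_nonneg_left (ih x hx y hy) hL0.le
  set θ : ℝ := ρ ^ (1 / k : ℝ) with hθ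
  have hθ0 : 0 < θ := Real.rpow_pos_of_pos hρ0 _
  have hθ1 : θ < 1 := Real.rpow_lt_one hρ0.le hρ1 (by positivity)
  have hθk : θ ^ k = ρ := by
    rw [hθ, one_div, Real.rpow_inv_natCast_pow hρ0.le hk0]
  -- Blocks of `k` letters contract by `ρ = θ ^ k`; the constant pays for the fewer than `k` letters
  -- left over, each expanding by at most `L`.
  refine ⟨L ^ k / θ ^ k, θ, by positivity, hθ0, hθ1, ?_⟩
  intro w
  induction hn : w.length using Nat.strong_induction_on generalizing w with
  | _ n ih =>
    intro x hx y hy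
    rcases lt_or_ge n k with hlt | hge
    · refine (hlip w x hx y hy).trans ?_
      gcongr
      rw [div_mul_eq_mul_div, le_div_iff₀ (by positivity), hn]
      have h1 : L ^ n ≤ L ^ k := pow_le_pow_right₀ hL1 hlt.le
      have h2 : θ ^ k ≤ θ ^ n := pow_le_pow_of_le_one hθ0.le hθ1.le hlt.le
      gcongr
    · have hw : wordMap f w = wordMap f (w.take k) ∘ wordMap f (w.drop k) := by
        rw [← wordMap_append, List.take_append_drop]
      have h1 := hcon (w.take k) (by rw [List.length_take, hn, min_eq_left hge]) _
        (hf.mapsTo_wordMap (w.drop k) hx) _ (hf.mapsTo_wordMap (w.drop k) hy)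
      have h2 := ih (n - k) (by omega) (w.drop k) (by rw [List.length_drop, hn]) x hx y hy
      rw [hw]
      refine h1.trans ((mul_le_mul_of_nonneg_left h2 hρ0.le).trans (le_of_eq ?_))
      have h3 : θ ^ n = ρ * θ ^ (n - k) := by
        rw [← hθk, ← pow_add, Nat.add_sub_cancel' hge]
      rw [h3]
      ring

/-! ### Codings and uniqueness of digits. -/

theorem wordMap_prefix_mem (hf : IsDecayingGaussLike d f) (a : ℕ → ℕ+) (n : ℕ) :
    wordMap f ((List.range n).map a) 1 ∈ Icc (0 : ℝ) 1 :=
  hf.mapsTo_wordMap _ (by norm_num)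

theorem exists_isCoding (hf : IsDecayingGaussLike d f) (a : ℕ → ℕ+) : ∃ x, IsCoding f a x := by
  obtain ⟨K, θ, hK, hθ0, hθ1, h⟩ := hf.exists_contraction_rate
  refine cauchySeq_tendsto_of_complete (cauchySeq_of_le_geometric θ K hθ1 fun n => ?_)
  have h1 : (1 : ℝ) ∈ Icc (0 : ℝ) 1 := by norm_num
  have h2 := hf.mapsTo (a n) h1
  have h3 := h ((List.range n).map a) 1 h1 _ h2
  rw [List.range_succ, List.map_append, wordMap_append, Real.dist_eq]
  refine h3.trans ?_
  rw [List.length_map, List.length_range]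
  refine mul_le_of_le_one_right (by positivity) ?_
  rw [abs_le]
  constructor <;> linarith [h2.1, h2.2]

theorem mem_Icc_of_isCoding (hf : IsDecayingGaussLike d f) {a : ℕ → ℕ+} {x : ℝ}
    (h : IsCoding f a x) : x ∈ Icc (0 : ℝ) 1 :=
  isClosed_Icc.mem_of_tendsto h (Eventually.of_forall fun n => hf.wordMap_prefix_mem a n)

theorem exists_isCoding_tail (hf : IsDecayingGaussLike d f) {a : ℕ → ℕ+} {x : ℝ}
    (h : IsCoding f a x) : ∃ u, IsCoding f (fun k => a (k + 1)) u ∧ x = f (a 0) u := by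
  obtain ⟨u, hu⟩ := hf.exists_isCoding fun k => a (k + 1)
  refine ⟨u, hu, ?_⟩
  have hc := (hf.contDiffOn (a 0)).continuousOn u (hf.mem_Icc_of_isCoding hu)
  have h1 := hc.tendsto.comp (tendsto_nhdsWithin_iff.2
    ⟨hu, Eventually.of_forall fun n => hf.wordMap_prefix_mem _ n⟩)
  refine tendsto_nhds_unique ((tendsto_add_atTop_iff_nat 1).2 h) (h1.congr fun n => ?_)
  simp only [List.range_succ_eq_map, List.map_cons, List.map_map, wordMap, Function.comp_def]

theorem exists_isCoding_shift (hf : IsDecayingGaussLike d f) {a : ℕ → ℕ+} {x : ℝ}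
    (h : IsCoding f a x) (n : ℕ) :
    ∃ u, IsCoding f (fun k => a (k + n)) u ∧ x = wordMap f ((List.range n).map a) u := by
  induction n with
  | zero => exact ⟨x, h, rfl⟩
  | succ n ih =>
    obtain ⟨u, hu, hx⟩ := ih
    obtain ⟨v, hv, hu'⟩ := hf.exists_isCoding_tail hu
    refine ⟨v, ?_, ?_⟩
    · simpa only [add_assoc, add_comm 1 n] using hv
    · rw [hx, hu', List.range_succ, List.map_append, wordMap_append]
      simp [wordMap]

/-- The images of `[0, 1]` are ordered from right to left. -/
theorem apply_le_apply (hf : IsDecayingGaussLike d f) {i j : ℕ+} (hij : j < i) :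
    ∀ x ∈ Icc (0 : ℝ) 1, ∀ y ∈ Icc (0 : ℝ) 1, f i x ≤ f j y := by
  have hc := fun i => (hf.contDiffOn i).continuousOn
  have hcl : closure (Ioo (0 : ℝ) 1) = Icc 0 1 := closure_Ioo zero_ne_one
  have h1 : ∀ x ∈ Ioo (0 : ℝ) 1, ∀ y ∈ Ioo (0 : ℝ) 1, f i x ≤ f j y := by
    intro x hx y hy
    -- Otherwise `f i x` lies strictly between `f j y` and `f j x`, hence in the open image of `f
    -- j`.
    by_contra! hlt
    have hsub : uIcc y x ⊆ Ioo (0 : ℝ) 1 := ordConnected_Ioo.uIcc_subset hy hx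
    have hivt := intermediate_value_uIcc ((hc j).mono (hsub.trans Ioo_subset_Icc_self))
    obtain ⟨z, hz, hz'⟩ := hivt (mem_uIcc.2 (Or.inl
      ⟨hlt.le, (hf.lt_of_lt i j hij x (Ioo_subset_Icc_self hx)).le⟩))
    exact (hf.openSet i j hij.ne').le_bot ⟨⟨x, hx, rfl⟩, ⟨z, hsub hz, hz'⟩⟩
  have h2 : ∀ x ∈ Ioo (0 : ℝ) 1, ∀ y ∈ Icc (0 : ℝ) 1, f i x ≤ f j y := by
    intro x hx y hy
    exact ContinuousWithinAt.closure_le (s := Ioo 0 1) (f := fun _ => f i x) (hcl ▸ hy)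
      continuousWithinAt_const ((hc j y hy).mono Ioo_subset_Icc_self) (h1 x hx)
  intro x hx y hy
  exact ContinuousWithinAt.closure_le (s := Ioo 0 1) (g := fun _ => f j y) (hcl ▸ hx)
    ((hc i x hx).mono Ioo_subset_Icc_self) continuousWithinAt_const fun z hz => h2 z hz y hy

theorem apply_pos (hf : IsDecayingGaussLike d f) (i : ℕ+) {x : ℝ} (hx : x ∈ Icc (0 : ℝ) 1) :
    0 < f i x := by
  have h : f i x ∈ ⋃ i, f i '' Icc 0 1 := mem_iUnion.2 ⟨i, x, hx, rfl⟩
  rw [hf.iUnion_image] at h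
  exact h.1

theorem apply_lt_one (hf : IsDecayingGaussLike d f) {i : ℕ+} (hi : i ≠ 1) {x : ℝ}
    (hx : x ∈ Icc (0 : ℝ) 1) : f i x < 1 := by
  have h0 : (0 : ℝ) ∈ Icc (0 : ℝ) 1 := by norm_num
  have h1 : (1 : ℝ) ∈ Icc (0 : ℝ) 1 := by norm_num
  have hi' : 1 < i := lt_of_le_of_ne one_le hi.symm
  have ha := hf.apply_le_apply hi' x hx 0 h0
  have hb := hf.apply_le_apply hi' x hx 1 h1
  refine lt_of_le_of_ne (hf.mapsTo i hx).2 fun he => zero_ne_one (hf.injOn 1 h0 h1 ?_)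
  linarith [(hf.mapsTo 1 h0).2, (hf.mapsTo 1 h1).2]

/-- Images being ordered, a common value of two of them is an extreme value of each, and a strictly
monotone map takes its extreme values only at endpoints. -/
theorem notMem_Ioo_of_apply_eq (hf : IsDecayingGaussLike d f) {i j : ℕ+} (hij : i ≠ j) {x y : ℝ}
    (hy : y ∈ Icc (0 : ℝ) 1) (h : f i x = f j y) : x ∉ Ioo (0 : ℝ) 1 := by
  intro hx
  have h0 : (0 : ℝ) ∈ Icc (0 : ℝ) 1 := by norm_num
  have h1 : (1 : ℝ) ∈ Icc (0 : ℝ) 1 := by norm_num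
  have hx' := Ioo_subset_Icc_self hx
  have hmono := (hf.contDiffOn i).continuousOn.strictMonoOn_of_injOn_Icc' zero_le_one (hf.injOn i)
  rcases lt_or_gt_of_ne hij with hlt | hlt
  · have ha := hf.apply_le_apply hlt y hy 0 h0
    have hb := hf.apply_le_apply hlt y hy 1 h1
    rcases hmono with hm | hm
    · linarith [hm h0 hx' hx.1]
    · linarith [hm hx' h1 hx.2]
  · have ha := hf.apply_le_apply hlt 0 h0 y hy
    have hb := hf.apply_le_apply hlt 1 h1 y hy
    rcases hmono with hm | hm
    · linarith [hm hx' h1 hx.2]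
    · linarith [hm h0 hx' hx.1]

/-- A sequence without the digit `1` is the digit sequence of the point it codes. -/
theorem isDigitSeq_of_ne_one (hf : IsDecayingGaussLike d f) {a : ℕ → ℕ+} {x : ℝ}
    (h : IsCoding f a x) (ha : ∀ k, a k ≠ 1) : x ∈ Ioo (0 : ℝ) 1 ∧ IsDigitSeq f a x := by
  -- Every tail of `a` codes an interior point, while a second coding would, at the first
  -- disagreement, force such a tail to be an endpoint.
  have hIoo : ∀ b : ℕ → ℕ+, ∀ z, IsCoding f b z → b 0 ≠ 1 → z ∈ Ioo (0 : ℝ) 1 := by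
    intro b z hz hb
    obtain ⟨u, hu, rfl⟩ := hf.exists_isCoding_tail hz
    exact ⟨hf.apply_pos _ (hf.mem_Icc_of_isCoding hu),
      hf.apply_lt_one hb (hf.mem_Icc_of_isCoding hu)⟩
  refine ⟨hIoo a x h (ha 0), h, fun b hb => ?_⟩
  by_contra hne
  have hex : ∃ n, b n ≠ a n := by
    by_contra! hall
    exact hne (funext hall)
  classical
  set n := Nat.find hex
  have hn : b n ≠ a n := Nat.find_spec hex
  have hpre : (List.range n).map b = (List.range n).map a := by
    refine List.map_congr_left fun k hk => ?_
    by_contra hk'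
    exact Nat.find_min hex (List.mem_range.1 hk) hk'
  obtain ⟨u, hu, hxu⟩ := hf.exists_isCoding_shift h n
  obtain ⟨v, hv, hxv⟩ := hf.exists_isCoding_shift hb n
  have huv : u = v := by
    refine hf.injOn_wordMap ((List.range n).map a) (hf.mem_Icc_of_isCoding hu)
      (hf.mem_Icc_of_isCoding hv) ?_
    rw [← hxu, hxv, hpre]
  obtain ⟨u', hu', hu1⟩ := hf.exists_isCoding_tail hu
  obtain ⟨v', hv', hv1⟩ := hf.exists_isCoding_tail hv
  simp only [zero_add] at hu1 hv1
  exact hf.notMem_Ioo_of_apply_eq hn.symm (hf.mem_Icc_of_isCoding hv')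
    (by rw [← hu1, ← hv1, huv]) (hIoo _ _ hu' (ha _))

end IsDecayingGaussLike

/-! ### Weights and weighted counts of non-decreasing words. -/

theorem exists_append_of_pairwise_le (M : ℕ) {w : List ℕ+} (hw : w.Pairwise (· ≤ ·)) :
    ∃ p r : List ℕ+, w = p ++ r ∧ (∀ j ∈ p, (j : ℕ) ≤ M) ∧ ∀ j ∈ r, M < (j : ℕ) := by
  induction w with
  | nil => exact ⟨[], [], rfl, by simp, by simp⟩
  | cons i w ih =>
    rw [List.pairwise_cons] at hw
    rcases le_or_gt (i : ℕ) M with h | h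
    · obtain ⟨p, r, rfl, hp, hr⟩ := ih hw.2
      exact ⟨i :: p, r, rfl, by simpa using ⟨h, hp⟩, hr⟩
    · refine ⟨[], i :: w, rfl, by simp, ?_⟩
      simp only [List.mem_cons, forall_eq_or_imp]
      exact ⟨h, fun j hj => h.trans_le (hw.1 j hj)⟩

/-- Cylinders of non-decreasing words are bounded by a product of weights of the letters, all the
weights being bounded away from `1`. -/
theorem IsDecayingGaussLike.exists_weights (hf : IsDecayingGaussLike d f) {D : ℝ} (hD0 : 0 < D)
    (hD : D < d) :
    ∃ K q C : ℝ, ∃ u : ℕ+ → ℝ, 0 < K ∧ 0 < q ∧ q < 1 ∧ 0 < C ∧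
      (∀ j, 0 < u j ∧ u j ≤ q ∧ u j ≤ C / (j : ℝ) ^ D) ∧
      ∀ w : List ℕ+, w.Pairwise (· ≤ ·) → ∀ x ∈ Icc (0 : ℝ) 1, ∀ y ∈ Icc (0 : ℝ) 1,
        |wordMap f w x - wordMap f w y| ≤ K * (w.map u).prod := by
  obtain ⟨K, θ, hK, hθ0, hθ1, hcon⟩ := hf.exists_contraction_rate
  obtain ⟨_, C₂, -, hC, hlip⟩ := hf.exists_bilipschitz (sub_pos.2 hD)
  simp only [sub_sub_cancel] at hlip
  obtain ⟨M, hM⟩ := eventually_atTop.1 (((tendsto_rpow_atTop hD0).comp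
    tendsto_natCast_atTop_atTop).eventually_ge_atTop (C₂ / θ))
  simp only [Function.comp_apply] at hM
  have hpos : ∀ j : ℕ+, (0 : ℝ) < (j : ℝ) := fun j => by exact_mod_cast j.pos
  -- Single maps with small letters need not contract, only long compositions do. Small letters form
  -- a prefix, so they get the mean rate `θ`; beyond `M` the derivative bound is itself at most `θ`.
  set u : ℕ+ → ℝ := fun j => if (j : ℕ) ≤ M then θ else C₂ / (j : ℝ) ^ D with hu
  have hu0 : ∀ j, 0 < u j := by
    intro j
    have := hpos j
    simp only [hu]
    split_ifs <;> positivity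
  refine ⟨K, θ, max C₂ (θ * (M : ℝ) ^ D), u, hK, hθ0, hθ1, hC.trans_le (le_max_left _ _),
    fun j => ⟨hu0 j, ?_, ?_⟩, ?_⟩
  · simp only [hu]
    split_ifs with h
    · exact le_rfl
    · have h1 := hM j (by omega)
      rw [div_le_iff₀ hθ0] at h1
      rw [div_le_iff₀ (Real.rpow_pos_of_pos (hpos j) _)]
      linarith
  · have := hpos j
    simp only [hu]
    split_ifs with h
    · rw [le_div_iff₀ (by positivity)]
      refine le_trans ?_ (le_max_right _ _)
      have : (j : ℝ) ≤ M := by exact_mod_cast h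
      gcongr
    · gcongr
      exact le_max_left _ _
  · intro w hw x hx y hy
    obtain ⟨p, r, rfl, hp, hr⟩ := exists_append_of_pairwise_le M hw
    have h1 : ∀ r : List ℕ+, (∀ j ∈ r, M < (j : ℕ)) →
        |wordMap f r x - wordMap f r y| ≤ (r.map u).prod * |x - y| := by
      intro r
      induction r with
      | nil => intro _; simp [wordMap]
      | cons i r ih =>
        intro hr
        simp only [List.mem_cons, forall_eq_or_imp] at hr
        have hi : u i = C₂ / (i : ℝ) ^ D := if_neg (not_le.2 hr.1)
        have h2 := (hlip i _ (hf.mapsTo_wordMap r hx) _ (hf.mapsTo_wordMap r hy)).2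
        rw [List.map_cons, List.prod_cons, mul_assoc]
        rw [← hi] at h2
        exact h2.trans (mul_le_mul_of_nonneg_left (ih hr.2) (hu0 i).le)
    have h2 : (p.map u).prod = θ ^ p.length := by
      rw [List.map_congr_left (g := fun _ => θ) fun j hj => if_pos (hp j hj), List.map_const',
        List.prod_replicate]
    have h3 : 0 ≤ (r.map u).prod := by
      refine List.prod_nonneg fun z hz => ?_
      obtain ⟨j, -, rfl⟩ := List.mem_map.1 hz
      exact (hu0 j).le
    rw [wordMap_append, List.map_append, List.prod_append, h2]
    refine (hcon p _ (hf.mapsTo_wordMap r hx) _ (hf.mapsTo_wordMap r hy)).trans ?_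
    rw [← mul_assoc]
    refine mul_le_mul_of_nonneg_left ((h1 r hr).trans (mul_le_of_le_one_right h3 ?_)) (by positivity)
    rw [abs_le]
    constructor <;> linarith [hx.1, hx.2, hy.1, hy.2]

/-- A sorted word is determined by its letter counts, so the left side is part of the expansion of a
product of geometric series. -/
theorem sum_pairwise_le_prod_le {α : Type*} [LinearOrder α] {J : Finset α} {n : ℕ}
    {S : Finset (List α)}
    (hS : ∀ w ∈ S, w.Pairwise (· ≤ ·) ∧ w.length = n ∧ ∀ j ∈ w, j ∈ J) {v : α → ℝ}
    (hv0 : ∀ j, 0 ≤ v j) (hv1 : ∀ j, v j < 1) :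
    ∑ w ∈ S, (w.map v).prod ≤ ∏ j ∈ J, (1 - v j)⁻¹ := by
  classical
  have hcount : ∀ w ∈ S, (w.map v).prod = ∏ j : J, v j ^ w.count (j : α) := by
    intro w hw
    rw [Finset.prod_list_map_count, Finset.prod_coe_sort J fun j => v j ^ w.count j]
    refine Finset.prod_subset (fun j hj => (hS w hw).2.2 j (List.mem_toFinset.1 hj)) ?_
    intro j _ hj
    rw [List.count_eq_zero_of_not_mem fun h => hj (List.mem_toFinset.2 h), pow_zero]
  have hinj : Set.InjOn (fun (w : List α) (j : J) => w.count (j : α)) (S : Set (List α)) := by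
    intro w hw w' hw' h
    refine List.Perm.eq_of_pairwise' (hS w hw).1 (hS w' hw').1 (List.perm_iff_count.2 fun j => ?_)
    by_cases hj : j ∈ J
    · exact congrFun h ⟨j, hj⟩
    · rw [List.count_eq_zero_of_not_mem fun h => hj ((hS w hw).2.2 j h),
        List.count_eq_zero_of_not_mem fun h => hj ((hS w' hw').2.2 j h)]
  have hgeom : ∀ j, ∑ c ∈ Finset.range (n + 1), v j ^ c ≤ (1 - v j)⁻¹ := fun j => by
    rw [← tsum_geometric_of_lt_one (hv0 j) (hv1 j)]
    exact (summable_geometric_of_lt_one (hv0 j) (hv1 j)).sum_le_tsum _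
      fun c _ => pow_nonneg (hv0 j) c
  calc ∑ w ∈ S, (w.map v).prod
      = ∑ w ∈ S, ∏ j : J, v j ^ w.count (j : α) := Finset.sum_congr rfl hcount
    _ = ∑ c ∈ S.image fun (w : List α) (j : J) => w.count (j : α), ∏ j : J, v j ^ c j :=
        by
        rw [Finset.sum_image hinj]
    _ ≤ ∑ c ∈ Fintype.piFinset fun _ : J => Finset.range (n + 1), ∏ j : J, v j ^ c j := by
        refine Finset.sum_le_sum_of_subset_of_nonneg ?_ fun c _ _ =>
          Finset.prod_nonneg fun j _ => pow_nonneg (hv0 j) _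
        intro c hc
        obtain ⟨w, hw, rfl⟩ := Finset.mem_image.1 hc
        refine Fintype.mem_piFinset.2 fun j => Finset.mem_range.2 ?_
        have := List.count_le_length (a := (j : α)) (l := w)
        rw [(hS w hw).2.1] at this
        exact Nat.lt_succ_of_le this
    _ = ∏ j : J, ∑ c ∈ Finset.range (n + 1), v j ^ c := by
        rw [Finset.prod_univ_sum]
    _ ≤ ∏ j : J, (1 - v j)⁻¹ := Finset.prod_le_prod
        (fun j _ => Finset.sum_nonneg fun c _ => pow_nonneg (hv0 j) c) fun j _ => hgeom j
    _ = ∏ j ∈ J, (1 - v j)⁻¹ := Finset.prod_coe_sort J fun j => (1 - v j)⁻¹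

theorem summable_inv_pow_mul_exp_rpow {r c β : ℝ} (hr : 1 < r) (hβ : β < 1) :
    Summable fun n : ℕ => (r ^ n)⁻¹ * Real.exp (c * (n : ℝ) ^ β) := by
  have hlog : 0 < Real.log r := Real.log_pos hr
  have hlim : Tendsto (fun n : ℕ => c * (n : ℝ) ^ (-(1 - β))) atTop (𝓝 (c * 0)) :=
    ((tendsto_rpow_neg_atTop (sub_pos.2 hβ)).comp tendsto_natCast_atTop_atTop).const_mul c
  rw [mul_zero] at hlim
  have hgeo : Summable fun n : ℕ => Real.exp (-(Real.log r / 2)) ^ n :=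
    summable_geometric_of_lt_one (Real.exp_pos _).le (Real.exp_lt_one_iff.2 (by linarith))
  refine Summable.of_norm_bounded_eventually_nat hgeo ?_
  filter_upwards [hlim.eventually_le_const (half_pos hlog), eventually_gt_atTop 0] with n hn hn0
  have hn0' : (0 : ℝ) < n := by exact_mod_cast hn0
  rw [Real.norm_of_nonneg (by positivity), ← Real.exp_nat_mul]
  have h1 : (r ^ n)⁻¹ = Real.exp (-(n * Real.log r)) := by
    rw [Real.exp_neg, Real.exp_nat_mul, Real.exp_log (by linarith)]
  rw [h1, ← Real.exp_add]
  refine Real.exp_le_exp.2 ?_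
  have h2 : (n : ℝ) ^ β = (n : ℝ) ^ (-(1 - β)) * n := by
    nth_rewrite 3 [← Real.rpow_one (n : ℝ)]
    rw [← Real.rpow_add hn0']
    ring_nf
  rw [h2]
  nlinarith [mul_le_mul_of_nonneg_right hn hn0'.le]

/-- Weighted count of all non-decreasing words whose letters are bounded in terms of the length. -/
theorem exists_sum_pairwise_le_prod_le {e β q C σ : ℝ} {v : ℕ+ → ℝ} (hq0 : 0 < q) (hq1 : q < 1)
    (hC : 0 ≤ C) (hσ : 1 - e < σ) (hβ : β < 1)
    (hv : ∀ j, 0 ≤ v j ∧ v j ≤ q ∧ v j ≤ C / (j : ℝ) ^ σ) :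
    ∃ B : ℝ, ∀ S : Finset (List ℕ+),
      (∀ w ∈ S, w.Pairwise (· ≤ ·) ∧ ∀ j ∈ w, (j : ℝ) ^ e ≤ (w.length : ℝ) ^ β) →
      ∑ w ∈ S, (w.map v).prod ≤ B := by
  classical
  have hpos : ∀ j : ℕ+, (0 : ℝ) < (j : ℝ) := fun j => by exact_mod_cast j.pos
  have hsum : Summable fun j : ℕ+ => 1 / (j : ℝ) ^ (σ + e) :=
    (Real.summable_one_div_nat_rpow.2 (by linarith)).comp_injective PNat.coe_injective
  set Z := ∑' j : ℕ+, 1 / (j : ℝ) ^ (σ + e) with hZ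
  -- Any `r` with `1 < r < 1 / q` would do: the product still converges with weights `r * v j`, and
  -- words of length `n` gain `r ^ (-n)`.
  set r := 2 / (1 + q) with hr
  have hr1 : 1 < r := by rw [hr, lt_div_iff₀ (by linarith)]; linarith
  have hr0 : 0 < r := by linarith
  have hrq : r * q < 1 := by rw [hr, div_mul_eq_mul_div, div_lt_iff₀ (by linarith)]; linarith
  set c := (1 - r * q)⁻¹ * (r * C) * Z with hc
  have hsm := summable_inv_pow_mul_exp_rpow (c := c) hr1 hβ
  refine ⟨∑' n : ℕ, (r ^ n)⁻¹ * Real.exp (c * (n : ℝ) ^ β), fun S hS => ?_⟩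
  have hlen : ∀ n, ∑ w ∈ S with w.length = n, (w.map v).prod ≤
      (r ^ n)⁻¹ * Real.exp (c * (n : ℝ) ^ β) := by
    intro n
    set T := S.filter fun w => w.length = n with hT
    set J : Finset ℕ+ := T.biUnion List.toFinset with hJ
    have hTJ : ∀ w ∈ T, w.Pairwise (· ≤ ·) ∧ w.length = n ∧ ∀ j ∈ w, j ∈ J := by
      intro w hw
      have hw' := Finset.mem_filter.1 hw
      exact ⟨(hS w hw'.1).1, hw'.2, fun j hj =>
        Finset.mem_biUnion.2 ⟨w, hw, List.mem_toFinset.2 hj⟩⟩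
    have hJn : ∀ j ∈ J, (j : ℝ) ^ e ≤ (n : ℝ) ^ β := by
      intro j hj
      obtain ⟨w, hw, hjw⟩ := Finset.mem_biUnion.1 hj
      have hw' := Finset.mem_filter.1 hw
      rw [← hw'.2]
      exact (hS w hw'.1).2 j (List.mem_toFinset.1 hjw)
    have hrv1 : ∀ j, r * v j ≤ r * q := fun j => mul_le_mul_of_nonneg_left (hv j).2.1 hr0.le
    have hmain := sum_pairwise_le_prod_le hTJ (v := fun j => r * v j)
      (fun j => mul_nonneg hr0.le (hv j).1) fun j => (hrv1 j).trans_lt hrq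
    have hL : ∑ w ∈ T, (w.map fun j => r * v j).prod = r ^ n * ∑ w ∈ T, (w.map v).prod := by
      rw [Finset.mul_sum]
      refine Finset.sum_congr rfl fun w hw => ?_
      rw [List.prod_map_mul, List.map_const', List.prod_replicate, (hTJ w hw).2.1]
    have hR : ∏ j ∈ J, (1 - r * v j)⁻¹ ≤ Real.exp (c * (n : ℝ) ^ β) := by
      have h1 : ∀ j ∈ J, (1 - r * v j)⁻¹ ≤
          Real.exp ((1 - r * q)⁻¹ * (r * C) * (1 / (j : ℝ) ^ (σ + e)) * (n : ℝ) ^ β) := by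
        intro j hj
        have hj0 := hpos j
        have h2 : 0 < 1 - r * v j := by linarith [hrv1 j]
        have h3 : (1 - r * v j)⁻¹ = r * v j * (1 - r * v j)⁻¹ + 1 := by field_simp; ring
        have h4 : (1 - r * v j)⁻¹ ≤ (1 - r * q)⁻¹ :=
          inv_anti₀ (by linarith) (by linarith [hrv1 j])
        -- The bound `j ^ e ≤ n ^ β` is traded for extra decay: `j ^ (-σ)` becomes the summable `j ^
        -- (-(σ + e))` at the cost of `n ^ β`.
        have h5 : v j ≤ C * (1 / (j : ℝ) ^ (σ + e)) * (n : ℝ) ^ β := by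
          refine (hv j).2.2.trans ?_
          have h6 : C / (j : ℝ) ^ σ = C * (1 / (j : ℝ) ^ (σ + e)) * (j : ℝ) ^ e := by
            rw [Real.rpow_add hj0]
            field_simp
          rw [h6]
          exact mul_le_mul_of_nonneg_left (hJn j hj) (by positivity)
        rw [h3]
        refine (Real.add_one_le_exp _).trans (Real.exp_le_exp.2 ?_)
        calc r * v j * (1 - r * v j)⁻¹
            ≤ r * (C * (1 / (j : ℝ) ^ (σ + e)) * (n : ℝ) ^ β) * (1 - r * q)⁻¹ := by
              refine mul_le_mul (mul_le_mul_of_nonneg_left h5 hr0.le) h4 (by positivity) ?_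
              positivity
          _ = _ := by ring
      refine (Finset.prod_le_prod (fun j _ => ?_) h1).trans ?_
      · exact inv_nonneg.2 (by linarith [hrv1 j])
      · rw [← Real.exp_sum, ← Finset.sum_mul, ← Finset.mul_sum]
        refine Real.exp_le_exp.2 (mul_le_mul_of_nonneg_right ?_ (by positivity))
        rw [hc]
        refine mul_le_mul_of_nonneg_left (hsum.sum_le_tsum _ fun j _ => ?_) ?_
        · have := hpos j
          positivity
        · have : 0 < 1 - r * q := by linarith
          positivity
    rw [hL] at hmain
    rw [inv_mul_eq_div, le_div_iff₀ (by positivity), mul_comm]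
    exact hmain.trans hR
  rw [← Finset.sum_fiberwise_of_maps_to (s := S) (t := S.image List.length) (g := List.length)
    fun w hw => Finset.mem_image_of_mem _ hw]
  exact (Finset.sum_le_sum fun n _ => hlen n).trans
    (hsm.sum_le_tsum _ fun n _ => by positivity)

/-! ### Upper bound: covering by cylinders of non-decreasing words. -/

theorem IsDecayingGaussLike.dimH_le_of_frequently (hf : IsDecayingGaussLike d f) {e β s : ℝ}
    (he : 0 ≤ e) (hβ : β < 1) (hs : 0 < s) (hse : 1 - e < s * d) :
    dimH {x | ∃ a : ℕ → ℕ+, IsCoding f a x ∧ Monotone a ∧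
      ∃ᶠ k in atTop, (a k : ℝ) ^ e ≤ ((k : ℝ) + 1) ^ β} ≤ ENNReal.ofReal s := by
  have hd := hf.one_lt
  obtain ⟨D, hD0, hDd, hD⟩ : ∃ D, 0 < D ∧ D < d ∧ 1 - e < s * D := by
    have h1 : max 0 ((1 - e) / s) < d :=
      max_lt (by linarith) (by rw [div_lt_iff₀ hs]; linarith)
    obtain ⟨D, h2, h3⟩ := exists_between h1
    refine ⟨D, (le_max_left _ _).trans_lt h2, h3, ?_⟩
    have := (le_max_right _ _).trans_lt h2
    rw [div_lt_iff₀ hs] at this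
    linarith
  obtain ⟨K, q, C, u, hK, hq0, hq1, hC, hu, hw⟩ := hf.exists_weights hD0 hDd
  obtain ⟨B, hB⟩ := exists_sum_pairwise_le_prod_le (v := fun j => u j ^ s) (q := q ^ s)
    (C := C ^ s) (σ := D * s) (e := e) (β := β) (Real.rpow_pos_of_pos hq0 s)
    (Real.rpow_lt_one hq0.le hq1 hs) (by positivity) (by linarith) hβ (by
      intro j
      have hj : (0 : ℝ) < (j : ℝ) := by exact_mod_cast j.pos
      have h0 := (hu j).1
      refine ⟨by positivity, Real.rpow_le_rpow h0.le (hu j).2.1 hs.le, ?_⟩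
      rw [Real.rpow_mul hj.le, ← Real.div_rpow hC.le (by positivity)]
      exact Real.rpow_le_rpow h0.le (hu j).2.2 hs.le)
  have hprod0 : ∀ w : List ℕ+, 0 ≤ (w.map u).prod := fun w => by
    refine List.prod_nonneg fun z hz => ?_
    obtain ⟨j, -, rfl⟩ := List.mem_map.1 hz
    exact (hu j).1.le
  have hprodq : ∀ w : List ℕ+, (w.map u).prod ≤ q ^ w.length := fun w => by
    induction w with
    | nil => simp
    | cons i w ih =>
      rw [List.map_cons, List.prod_cons, List.length_cons, pow_succ']
      exact mul_le_mul (hu i).2.1 ih (hprod0 w) hq0.le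
  have hprods : ∀ w : List ℕ+, (w.map fun j => u j ^ s).prod = (w.map u).prod ^ s := fun w => by
    induction w with
    | nil => simp
    | cons i w ih =>
      simp only [List.map_cons, List.prod_cons]
      rw [ih, Real.mul_rpow (hu i).1.le (hprod0 w)]
  set 𝒲 : Set (List ℕ+) :=
    {w | w.Pairwise (· ≤ ·) ∧ ∀ j ∈ w, (j : ℝ) ^ e ≤ (w.length : ℝ) ^ β} with h𝒲
  have hdiam : ∀ w ∈ 𝒲, Metric.ediam (wordMap f w '' Icc 0 1) ≤
      ENNReal.ofReal (K * (w.map u).prod) := by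
    intro w hw'
    refine Metric.ediam_le_of_forall_dist_le ?_
    rintro _ ⟨x, hx, rfl⟩ _ ⟨y, hy, rfl⟩
    exact hw w hw'.1 x hx y hy
  let s' : NNReal := ⟨s, hs.le⟩
  have hs' : ENNReal.ofReal s = (s' : ENNReal) := ENNReal.ofReal_eq_coe_nnreal hs.le
  rw [hs']
  refine dimH_le_of_hausdorffMeasure_ne_top ?_
  refine ne_top_of_le_ne_top (ENNReal.ofReal_ne_top (r := K ^ s * B)) ?_
  refine (MeasureTheory.Measure.hausdorffMeasure_le_liminf_tsum (l := atTop) (s' : ℝ) _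
    (ι := fun N : ℕ => {w : List ℕ+ // w ∈ 𝒲 ∧ N ≤ w.length})
    (fun N : ℕ => ENNReal.ofReal (K * q ^ N)) ?_
    (fun N w => wordMap f w.1 '' Icc 0 1) (Eventually.of_forall ?_)
    (Eventually.of_forall ?_)).trans ?_
  · have h1 := (tendsto_pow_atTop_nhds_zero_of_lt_one hq0.le hq1).const_mul K
    have h2 := ENNReal.tendsto_ofReal h1
    rwa [mul_zero, ENNReal.ofReal_zero] at h2
  · rintro N ⟨w, hw', hN⟩
    refine (hdiam w hw').trans (ENNReal.ofReal_le_ofReal ?_)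
    refine mul_le_mul_of_nonneg_left ((hprodq w).trans ?_) hK.le
    exact pow_le_pow_of_le_one hq0.le hq1.le hN
  -- The covering word is the prefix of length `k + 1`; its largest letter is the last, so a bound
  -- on `a k` bounds them all.
  · rintro N x ⟨a, hax, hmono, hfreq⟩
    obtain ⟨k, hkN, hk⟩ := (frequently_atTop.1 hfreq) N
    obtain ⟨z, hz, hxz⟩ := hf.exists_isCoding_shift hax (k + 1)
    refine mem_iUnion.2 ⟨⟨(List.range (k + 1)).map a, ⟨?_, ?_⟩, ?_⟩, z,
      hf.mem_Icc_of_isCoding hz, hxz.symm⟩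
    · rw [List.pairwise_map]
      exact (List.pairwise_lt_range (n := k + 1)).imp fun h => hmono h.le
    · intro j hj
      obtain ⟨i, hi, rfl⟩ := List.mem_map.1 hj
      rw [List.mem_range] at hi
      have hik : (a i : ℝ) ≤ (a k : ℝ) := by
        exact_mod_cast (hmono (Nat.lt_succ_iff.1 hi) : a i ≤ a k)
      rw [List.length_map, List.length_range, Nat.cast_succ]
      exact (Real.rpow_le_rpow (by positivity) hik he).trans hk
    · rw [List.length_map, List.length_range]
      omega
  · refine (liminf_le_liminf (v := fun _ => ENNReal.ofReal (K ^ s * B))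
      (Eventually.of_forall fun N => ?_)).trans_eq (liminf_const _)
    rw [ENNReal.tsum_eq_iSup_sum]
    refine iSup_le fun S => ?_
    have hterm : ∀ w ∈ 𝒲, Metric.ediam (wordMap f w '' Icc 0 1) ^ (s' : ℝ) ≤
        ENNReal.ofReal (K ^ s * (w.map fun j => u j ^ s).prod) := by
      intro w hw'
      refine (ENNReal.rpow_le_rpow (hdiam w hw') s'.coe_nonneg).trans_eq ?_
      rw [ENNReal.ofReal_rpow_of_nonneg (mul_nonneg hK.le (hprod0 w)) s'.coe_nonneg, hprods,
        ← Real.mul_rpow hK.le (hprod0 w)]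
      rfl
    refine (Finset.sum_le_sum fun w _ => hterm w.1 w.2.1).trans ?_
    rw [← ENNReal.ofReal_sum_of_nonneg fun w _ =>
      mul_nonneg (by positivity) (by rw [hprods]; exact Real.rpow_nonneg (hprod0 _) _),
      ← Finset.mul_sum]
    refine ENNReal.ofReal_le_ofReal (mul_le_mul_of_nonneg_left ?_ (by positivity))
    have h1 := hB (S.map (Function.Embedding.subtype _)) (by
      intro w hw'
      obtain ⟨w', -, rfl⟩ := Finset.mem_map.1 hw'
      exact w'.2.1)
    rwa [Finset.sum_map] at h1

/-! ### Cantor series and Hölder parametrisations. -/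

/-- The remainders of the Cantor series expansion of `y` with bases `q 0, q 1, …`. -/
def cantorRem (q : ℕ → ℕ) (y : ℝ) : ℕ → ℝ
  | 0 => y
  | k + 1 => Int.fract (q k * cantorRem q y k)

/-- The digits of the Cantor series expansion of `y` with bases `q 0, q 1, …`. -/
def cantorDigit (q : ℕ → ℕ) (y : ℝ) (k : ℕ) : ℕ := ⌊q k * cantorRem q y k⌋₊

theorem cantorRem_mem (q : ℕ → ℕ) {y : ℝ} (hy : y ∈ Ico (0 : ℝ) 1) (k : ℕ) :
    cantorRem q y k ∈ Ico (0 : ℝ) 1 := by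
  cases k with
  | zero => exact hy
  | succ k => exact ⟨Int.fract_nonneg _, Int.fract_lt_one _⟩

theorem cantorDigit_lt {q : ℕ → ℕ} {y : ℝ} (hy : y ∈ Ico (0 : ℝ) 1) {k : ℕ} (hq : 0 < q k) :
    cantorDigit q y k < q k := by
  have h := cantorRem_mem q hy k
  have hq' : (0 : ℝ) < q k := by exact_mod_cast hq
  refine (Nat.floor_lt (mul_nonneg hq'.le h.1)).2 ?_
  nlinarith [h.2]

theorem cantorRem_succ (q : ℕ → ℕ) {y : ℝ} (hy : y ∈ Ico (0 : ℝ) 1) (k : ℕ) :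
    cantorRem q y (k + 1) = q k * cantorRem q y k - cantorDigit q y k := by
  have h := mul_nonneg (Nat.cast_nonneg (α := ℝ) (q k)) (cantorRem_mem q hy k).1
  rw [cantorDigit, natCast_floor_eq_intCast_floor h]
  rfl

/-- Each common digit cancels in the difference of remainders, so this difference is just multiplied
by `q k`, and remainders stay in `[0, 1)`. -/
theorem prod_mul_abs_sub_le_one {q : ℕ → ℕ} {y z : ℝ} (hy : y ∈ Ico (0 : ℝ) 1)
    (hz : z ∈ Ico (0 : ℝ) 1) {n : ℕ} (h : ∀ k < n, cantorDigit q y k = cantorDigit q z k) :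
    (∏ k ∈ Finset.range n, (q k : ℝ)) * |y - z| ≤ 1 := by
  have key : (∏ k ∈ Finset.range n, (q k : ℝ)) * |y - z| = |cantorRem q y n - cantorRem q z n| := by
    induction n with
    | zero => simp [cantorRem]
    | succ n ih =>
      rw [Finset.prod_range_succ, mul_right_comm, ih fun k hk => h k (hk.trans n.lt_succ_self),
        cantorRem_succ q hy, cantorRem_succ q hz, h n n.lt_succ_self, sub_sub_sub_cancel_right,
        ← mul_sub, abs_mul, Nat.abs_cast, mul_comm]
  have h1 := cantorRem_mem q hy n
  have h2 := cantorRem_mem q hz n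
  rw [key, abs_le]
  constructor <;> linarith [h1.1, h1.2, h2.1, h2.2]

theorem exists_forall_le_of_eventually_succ_le {x : ℕ → ℝ} (h : ∀ᶠ n in atTop, x (n + 1) ≤ x n) :
    ∃ c, ∀ n, x n ≤ c := by
  obtain ⟨N, hN⟩ := eventually_atTop.1 h
  obtain ⟨c, hc⟩ := ((Finset.range (N + 1)).image x).exists_le
  have hc' : ∀ n ≤ N, x n ≤ c := fun n hn =>
    hc _ (Finset.mem_image_of_mem _ (Finset.mem_range.2 (Nat.lt_succ_of_le hn)))
  refine ⟨c, fun n => ?_⟩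
  rcases le_total n N with hn | hn
  · exact hc' n hn
  · induction n, hn using Nat.le_induction with
    | base => exact hc' N le_rfl
    | succ n hn ih => exact (hN n hn).trans ih

/-- The inverse of `φ` is `s`-Hölder and maps onto a set of dimension one. -/
theorem le_dimH_image_of_abs_sub_le {φ : ℝ → ℝ} {c s : ℝ} (hs : 0 < s) (hc : 0 ≤ c)
    (h : ∀ y ∈ Ico (0 : ℝ) 1, ∀ z ∈ Ico (0 : ℝ) 1, |y - z| ≤ c * |φ y - φ z| ^ s) :
    ENNReal.ofReal s ≤ dimH (φ '' Ico 0 1) := by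
  have hinj : InjOn φ (Ico 0 1) := by
    intro y hy z hz hyz
    have h1 := h y hy z hz
    rw [hyz, sub_self, abs_zero, Real.zero_rpow hs.ne', mul_zero] at h1
    exact sub_eq_zero.1 (abs_eq_zero.1 (le_antisymm h1 (abs_nonneg _)))
  have hleft : LeftInvOn (Function.invFunOn φ (Ico 0 1)) φ (Ico 0 1) := hinj.leftInvOn_invFunOn
  have hholder : HolderOnWith c.toNNReal s.toNNReal (Function.invFunOn φ (Ico 0 1))
      (φ '' Ico 0 1) := by
    rintro _ ⟨y, hy, rfl⟩ _ ⟨z, hz, rfl⟩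
    rw [hleft hy, hleft hz, edist_dist, edist_dist, Real.dist_eq, Real.dist_eq,
      Real.coe_toNNReal s hs.le, ENNReal.ofReal_rpow_of_nonneg (abs_nonneg _) hs.le]
    change _ ≤ ENNReal.ofReal c * _
    rw [← ENNReal.ofReal_mul hc]
    exact ENNReal.ofReal_le_ofReal (h y hy z hz)
  have h1 := hholder.dimH_image_le (Real.toNNReal_pos.2 hs)
  rw [hleft.image_image, Real.dimH_of_nonempty_interior (by simp), Module.finrank_self,
    Nat.cast_one] at h1
  change 1 ≤ dimH (φ '' Ico 0 1) / ENNReal.ofReal s at h1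
  rwa [ENNReal.le_div_iff_mul_le (Or.inl (by simpa using hs)) (Or.inl ENNReal.ofReal_ne_top),
    one_mul] at h1

/-! ### Lower bound: points with digits in prescribed blocks. -/

namespace IsDecayingGaussLike

theorem prod_mul_le_abs_wordMap_sub (hf : IsDecayingGaussLike d f) {C D : ℝ} (hC : 0 < C)
    (h : ∀ i : ℕ+, ∀ x ∈ Icc (0 : ℝ) 1, ∀ y ∈ Icc (0 : ℝ) 1,
      C / (i : ℝ) ^ D * |x - y| ≤ |f i x - f i y|) (a : ℕ → ℕ+) (n : ℕ) :
    ∀ x ∈ Icc (0 : ℝ) 1, ∀ y ∈ Icc (0 : ℝ) 1,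
      (∏ k ∈ Finset.range n, C / (a k : ℝ) ^ D) * |x - y| ≤
        |wordMap f ((List.range n).map a) x - wordMap f ((List.range n).map a) y| := by
  induction n with
  | zero => intro x _ y _; simp [wordMap]
  | succ n ih =>
    intro x hx y hy
    rw [List.range_succ, List.map_append, wordMap_append, Finset.prod_range_succ, mul_assoc]
    refine le_trans ?_ (ih _ (hf.mapsTo (a n) hx) _ (hf.mapsTo (a n) hy))
    exact mul_le_mul_of_nonneg_left (h _ x hx y hy) (Finset.prod_nonneg fun k _ => by positivity)

/-- The whole image of `f (i + 1)` lies in between; this is why blocks use alternate integers. -/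
theorem le_apply_sub_apply (hf : IsDecayingGaussLike d f) {C D : ℝ}
    (h : ∀ i : ℕ+, ∀ x ∈ Icc (0 : ℝ) 1, ∀ y ∈ Icc (0 : ℝ) 1,
      C / (i : ℝ) ^ D * |x - y| ≤ |f i x - f i y|) {i j : ℕ+} (hij : i + 1 < j) {x y : ℝ}
    (hx : x ∈ Icc (0 : ℝ) 1) (hy : y ∈ Icc (0 : ℝ) 1) :
    C / ((i + 1 : ℕ+) : ℝ) ^ D ≤ f i x - f j y := by
  have h0 : (0 : ℝ) ∈ Icc (0 : ℝ) 1 := by norm_num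
  have h1 : (1 : ℝ) ∈ Icc (0 : ℝ) 1 := by norm_num
  have hi : i < i + 1 := PNat.lt_add_right i 1
  have h2 := h (i + 1) 0 h0 1 h1
  rw [zero_sub, abs_neg, abs_one, mul_one] at h2
  refine h2.trans (abs_le.2 ⟨?_, ?_⟩)
  · linarith [hf.apply_le_apply hij y hy 0 h0, hf.apply_le_apply hi 1 h1 x hx]
  · linarith [hf.apply_le_apply hij y hy 1 h1, hf.apply_le_apply hi 0 h0 x hx]

/-- Lower bound for the dimension of the points whose `k`-th digit ranges over `q k` alternate
integers starting from `B k`. -/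
theorem le_dimH_of_digit_blocks (hf : IsDecayingGaussLike d f) {s D : ℝ} (hs : 0 < s) (hD : d < D)
    {B q : ℕ → ℕ} (hB : ∀ k, 2 ≤ B k) (hq : ∀ k, 0 < q k)
    (hstep : ∀ k, B k + 2 * q k ≤ B (k + 1) + 2)
    (hgrow : ∀ C : ℝ, 0 < C → ∀ᶠ k in atTop,
      C * ((B (k + 1) + 2 * q (k + 1) : ℕ) : ℝ) ^ (D * s) ≤ q k) :
    ENNReal.ofReal s ≤ dimH {x | x ∈ Lam f ∧ ∃ a, IsDigitSeq f a x ∧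
      ∀ k, B k ≤ (a k : ℕ) ∧ (a k : ℕ) ≤ B k + 2 * q k} := by
  have hd := hf.one_lt
  obtain ⟨C₁, _, hC₁, -, hlip'⟩ := hf.exists_bilipschitz (sub_pos.2 hD)
  have hlip : ∀ i : ℕ+, ∀ x ∈ Icc (0 : ℝ) 1, ∀ y ∈ Icc (0 : ℝ) 1,
      C₁ / (i : ℝ) ^ D * |x - y| ≤ |f i x - f i y| := by
    intro i x hx y hy
    simpa only [add_sub_cancel] using (hlip' i x hx y hy).1
  set A : ℕ → ℕ := fun k => B k + 2 * q k with hA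
  have hA1 : ∀ k, (1 : ℝ) ≤ A k := fun k => by
    have := hB k
    exact_mod_cast (by simp only [hA]; omega : 1 ≤ A k)
  have hA0 : ∀ k, (0 : ℝ) < A k := fun k => one_pos.trans_le (hA1 k)
  -- The first entry lets `(W k)⁻¹` bound contraction ratios from below; the second gives `W k ^ s ≥
  -- 2`, used to show that the digits determine `y`.
  set g : ℝ := max C₁⁻¹ (2 ^ s⁻¹) with hg
  have hg0 : 0 < g := (inv_pos.2 hC₁).trans_le (le_max_left _ _)
  have hgs : 2 ≤ g ^ s := by
    have h1 := Real.rpow_le_rpow (by positivity) (le_max_right C₁⁻¹ ((2 : ℝ) ^ s⁻¹)) hs.le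
    rwa [Real.rpow_inv_rpow (by norm_num) hs.ne'] at h1
  set W : ℕ → ℝ := fun k => g * (A k : ℝ) ^ D with hW
  have hW0 : ∀ k, 0 < W k := fun k => by have := hA0 k; positivity
  have hq0 : ∀ k, (0 : ℝ) < q k := fun k => by exact_mod_cast hq k
  have hP0 : ∀ n, 0 < ∏ k ∈ Finset.range n, (q k : ℝ) := fun n =>
    Finset.prod_pos fun k _ => hq0 k
  -- Separation at level `n` costs one more factor `W` than there are factors `q`, so the ratio of
  -- consecutive terms is `W (n + 1) ^ s / q n`, eventually at most one by `hgrow`.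
  obtain ⟨c, hc⟩ : ∃ c, ∀ n, (∏ k ∈ Finset.range (n + 1), W k ^ s) /
      ∏ k ∈ Finset.range n, (q k : ℝ) ≤ c := by
    refine exists_forall_le_of_eventually_succ_le ?_
    filter_upwards [hgrow (g ^ s) (by positivity)] with n hn
    have h1 : W (n + 1) ^ s ≤ q n := by
      rw [hW, Real.mul_rpow hg0.le (by positivity), ← Real.rpow_mul (Nat.cast_nonneg _)]
      exact hn
    have h2 : 0 ≤ ∏ k ∈ Finset.range (n + 1), W k ^ s :=
      Finset.prod_nonneg fun k _ => Real.rpow_nonneg (hW0 k).le s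
    have h3 := hP0 n
    have h4 := hq0 n
    rw [Finset.prod_range_succ _ (n + 1), Finset.prod_range_succ (fun k => (q k : ℝ)) n,
      mul_div_mul_comm]
    exact mul_le_of_le_one_right (by positivity) ((div_le_one h4).2 h1)
  have hc0 : 0 ≤ c := le_trans (div_nonneg (Finset.prod_nonneg fun k _ =>
    Real.rpow_nonneg (hW0 k).le s) (hP0 0).le) (hc 0)
  have hc' : ∀ n, ∏ k ∈ Finset.range (n + 1), W k ^ s ≤ c * ∏ k ∈ Finset.range n, (q k : ℝ) :=
    fun n => (div_le_iff₀ (hP0 n)).1 (hc n)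
  set a : ℝ → ℕ → ℕ+ := fun y k =>
    ⟨B k + 2 * cantorDigit q y k, by have := hB k; omega⟩ with ha
  have haval : ∀ y k, (a y k : ℕ) = B k + 2 * cantorDigit q y k := fun y k => rfl
  choose φ hφ using fun y => hf.exists_isCoding (a y)
  have hdig : ∀ y ∈ Ico (0 : ℝ) 1, ∀ k, (a y k : ℕ) + 2 ≤ A k := fun y hy k => by
    have := cantorDigit_lt hy (hq k)
    rw [haval]
    simp only [hA]
    omega
  have hfac : ∀ k, ∀ i : ℕ+, (i : ℕ) ≤ A k → (W k)⁻¹ ≤ C₁ / (i : ℝ) ^ D := by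
    intro k i hi
    have hi0 : (0 : ℝ) < (i : ℝ) := by exact_mod_cast i.pos
    have hi' : (i : ℝ) ≤ A k := by exact_mod_cast hi
    rw [hW, mul_inv, div_eq_mul_inv]
    refine mul_le_mul (inv_le_of_inv_le₀ hC₁ (le_max_left _ _)) ?_ (by positivity) hC₁.le
    exact inv_anti₀ (by positivity) (Real.rpow_le_rpow hi0.le hi' (by linarith))
  -- With `n` the first disagreement, the common prefix contracts by at least the product of `(W
  -- k)⁻¹` over `k < n`, and the gap at level `n` supplies the last factor.
  have hsep : ∀ y ∈ Ico (0 : ℝ) 1, ∀ z ∈ Ico (0 : ℝ) 1, ∀ n,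
      (∀ k < n, cantorDigit q y k = cantorDigit q z k) → cantorDigit q y n < cantorDigit q z n →
      |y - z| ≤ c * |φ y - φ z| ^ s := by
    intro y hy z hz n hlt hn
    obtain ⟨u, hu, hyu⟩ := hf.exists_isCoding_shift (hφ y) n
    obtain ⟨v, hv, hzv⟩ := hf.exists_isCoding_shift (hφ z) n
    obtain ⟨u', hu', rfl⟩ := hf.exists_isCoding_tail hu
    obtain ⟨v', hv', rfl⟩ := hf.exists_isCoding_tail hv
    have hu1 := hf.mem_Icc_of_isCoding hu'
    have hv1 := hf.mem_Icc_of_isCoding hv'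
    have hpre : (List.range n).map (a z) = (List.range n).map (a y) := by
      refine List.map_congr_left fun k hk => PNat.eq ?_
      rw [haval, haval, hlt k (List.mem_range.1 hk)]
    have h1 := hf.prod_mul_le_abs_wordMap_sub hC₁ hlip (a y) n _
      (hf.mem_Icc_of_isCoding hu) _ (hf.mem_Icc_of_isCoding hv)
    rw [← hyu, ← hpre, ← hzv] at h1
    simp only [zero_add] at h1
    have hlt' : a y n + 1 < a z n := by
      rw [← PNat.coe_lt_coe, PNat.add_coe, haval, haval, PNat.one_coe]
      omega
    have h2 := (hf.le_apply_sub_apply hlip hlt' hu1 hv1).trans (le_abs_self _)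
    have h3 : ∏ k ∈ Finset.range (n + 1), (W k)⁻¹ ≤ |φ y - φ z| := by
      refine le_trans ?_ h1
      rw [Finset.prod_range_succ]
      refine mul_le_mul (Finset.prod_le_prod (fun k _ => (inv_pos.2 (hW0 k)).le) fun k _ =>
        hfac k _ (by have := hdig y hy k; omega)) (le_trans (hfac n _ ?_) h2)
        (inv_pos.2 (hW0 n)).le (Finset.prod_nonneg fun k _ => by positivity)
      have := hdig y hy n
      rw [PNat.add_coe, PNat.one_coe]
      omega
    have h4 := Real.rpow_le_rpow (Finset.prod_nonneg fun k _ => (inv_pos.2 (hW0 k)).le) h3 hs.le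
    have h5 : 0 < ∏ k ∈ Finset.range (n + 1), W k ^ s :=
      Finset.prod_pos fun k _ => Real.rpow_pos_of_pos (hW0 k) s
    rw [← Real.finsetProd_rpow _ _ fun k _ => (inv_pos.2 (hW0 k)).le] at h4
    simp_rw [fun k => Real.inv_rpow (hW0 k).le s] at h4
    rw [Finset.prod_inv_distrib] at h4
    have h6 := prod_mul_abs_sub_le_one hy hz hlt
    refine le_trans ?_ (mul_le_mul_of_nonneg_left h4 hc0)
    rw [← div_eq_mul_inv, le_div_iff₀ h5]
    calc |y - z| * ∏ k ∈ Finset.range (n + 1), W k ^ s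
        ≤ |y - z| * (c * ∏ k ∈ Finset.range n, (q k : ℝ)) :=
          mul_le_mul_of_nonneg_left (hc' n) (abs_nonneg _)
      _ = c * ((∏ k ∈ Finset.range n, (q k : ℝ)) * |y - z|) := by ring
      _ ≤ c := mul_le_of_le_one_right hc0 h6
  have heq : ∀ y ∈ Ico (0 : ℝ) 1, ∀ z ∈ Ico (0 : ℝ) 1,
      (∀ k, cantorDigit q y k = cantorDigit q z k) → |y - z| = 0 := by
    intro y hy z hz hall
    have h1 : ∀ n : ℕ, |y - z| ≤ c * (1 / 2) ^ n := by
      intro n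
      have h2 : (2 : ℝ) ^ (n + 1) ≤ ∏ k ∈ Finset.range (n + 1), W k ^ s := by
        rw [← Finset.card_range (n + 1), ← Finset.prod_const, Finset.card_range]
        refine Finset.prod_le_prod (fun _ _ => by norm_num) fun k _ => hgs.trans ?_
        refine Real.rpow_le_rpow hg0.le (le_mul_of_one_le_right hg0.le ?_) hs.le
        exact Real.one_le_rpow (hA1 k) (by linarith)
      have h3 := prod_mul_abs_sub_le_one (n := n) hy hz fun k _ => hall k
      have h4 : (2 : ℝ) ^ n ≤ 2 ^ (n + 1) := pow_le_pow_right₀ (by norm_num) n.le_succ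
      rw [one_div, inv_pow, ← div_eq_mul_inv, le_div_iff₀ (by positivity)]
      calc |y - z| * 2 ^ n ≤ |y - z| * (c * ∏ k ∈ Finset.range n, (q k : ℝ)) :=
            mul_le_mul_of_nonneg_left ((h4.trans h2).trans (hc' n)) (abs_nonneg _)
        _ = c * ((∏ k ∈ Finset.range n, (q k : ℝ)) * |y - z|) := by ring
        _ ≤ c := mul_le_of_le_one_right hc0 h3
    have h2 : Tendsto (fun n : ℕ => c * (1 / 2 : ℝ) ^ n) atTop (𝓝 (c * 0)) :=
      (tendsto_pow_atTop_nhds_zero_of_lt_one (by norm_num) (by norm_num)).const_mul c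
    rw [mul_zero] at h2
    exact le_antisymm (ge_of_tendsto' h2 h1) (abs_nonneg _)
  refine (le_dimH_image_of_abs_sub_le hs hc0 (φ := φ) fun y hy z hz => ?_).trans (dimH_mono ?_)
  · by_cases hall : ∀ k, cantorDigit q y k = cantorDigit q z k
    · rw [heq y hy z hz hall]
      positivity
    · push Not at hall
      classical
      have hlt : ∀ k < Nat.find hall, cantorDigit q y k = cantorDigit q z k := fun k hk => by
        by_contra hne
        exact Nat.find_min hall hk hne
      rcases lt_or_gt_of_ne (Nat.find_spec hall) with h | h
      · exact hsep y hy z hz _ hlt h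
      · rw [abs_sub_comm, abs_sub_comm (φ y)]
        exact hsep z hz y hy _ (fun k hk => (hlt k hk).symm) h
  · rintro _ ⟨y, hy, rfl⟩
    have hne : ∀ k, a y k ≠ 1 := by
      intro k h
      have h1 := haval y k
      have h2 := hB k
      rw [h, PNat.one_coe] at h1
      omega
    obtain ⟨h1, h2⟩ := hf.isDigitSeq_of_ne_one (hφ y) hne
    refine ⟨⟨h1, a y, h2, fun k => ?_⟩, a y, h2, fun k => ?_⟩
    · rw [← PNat.coe_le_coe, haval y (k + 1)]
      have h3 := hdig y hy k
      have h4 := hstep k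
      simp only [hA] at h3
      omega
    · have h3 := hdig y hy k
      have h4 := haval y k
      simp only [hA] at h3
      omega

end IsDecayingGaussLike

/-! ### Lower rates and growth of digits. -/

theorem log_prod_rpow {m : ℕ} (t : Fin (m + 1) → ℝ) (a : ℕ → ℕ+) (k : ℕ) :
    Real.log (∏ i : Fin (m + 1), ((a (k + (i : ℕ)) : ℕ) : ℝ) ^ t i) =
      ∑ i : Fin (m + 1), t i * Real.log ((a (k + (i : ℕ)) : ℕ) : ℝ) := by
  have hpos : ∀ j, (0 : ℝ) < ((a j : ℕ) : ℝ) := fun j => by exact_mod_cast (a j).pos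
  rw [Real.log_prod fun i _ => (Real.rpow_pos_of_pos (hpos _) _).ne']
  exact Finset.sum_congr rfl fun i _ => Real.log_rpow (hpos _) _

theorem log_natCast_pnat_nonneg (j : ℕ+) : 0 ≤ Real.log ((j : ℕ) : ℝ) :=
  Real.log_nonneg (by exact_mod_cast j.pos)

theorem frequently_le_rpow_of_lowerRate_lt {m : ℕ} {t : Fin (m + 1) → ℝ} (ht : ∀ i, 0 ≤ t i)
    (hT : 0 < ∑ i, t i) {a : ℕ → ℕ+} (ha : Monotone a) {x : ℝ}
    (h : lowerRate t a < (x : EReal)) :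
    ∃ᶠ k in atTop, ((a k : ℕ) : ℝ) ≤ ((k : ℝ) + 1) ^ (x / ∑ i, t i) := by
  have h1 := frequently_lt_of_liminf_lt (by isBoundedDefault) h
  refine (h1.and_eventually (eventually_ge_atTop 1)).mono ?_
  rintro k ⟨hk, hk1⟩
  have hk1' : (1 : ℝ) ≤ k := by exact_mod_cast hk1
  have hlog : 0 < Real.log ((k : ℝ) + 1) := Real.log_pos (by linarith)
  rw [EReal.coe_lt_coe_iff, div_lt_iff₀ hlog, log_prod_rpow] at hk
  have hak : (0 : ℝ) < ((a k : ℕ) : ℝ) := by exact_mod_cast (a k).pos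
  have h2 : (∑ i, t i) * Real.log ((a k : ℕ) : ℝ) ≤
      ∑ i : Fin (m + 1), t i * Real.log ((a (k + (i : ℕ)) : ℕ) : ℝ) := by
    rw [Finset.sum_mul]
    refine Finset.sum_le_sum fun i _ => mul_le_mul_of_nonneg_left (Real.log_le_log hak ?_) (ht i)
    exact_mod_cast (ha (Nat.le_add_right k i) : a k ≤ a (k + i))
  rw [← Real.log_le_log_iff hak (by positivity), Real.log_rpow (by positivity), div_mul_eq_mul_div,
    le_div_iff₀ hT]
  linarith

theorem tendsto_log_div_log {b : ℕ → ℝ} {γ c₁ c₂ : ℝ} (hc₁ : 0 < c₁)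
    (h₁ : ∀ k : ℕ, c₁ * ((k : ℝ) + 1) ^ γ ≤ b k) (h₂ : ∀ k : ℕ, b k ≤ c₂ * ((k : ℝ) + 1) ^ γ) :
    Tendsto (fun k : ℕ => Real.log (b k) / Real.log ((k : ℝ) + 1)) atTop (𝓝 γ) := by
  have hlog : Tendsto (fun k : ℕ => Real.log ((k : ℝ) + 1)) atTop atTop :=
    Real.tendsto_log_atTop.comp (tendsto_atTop_add_const_right _ 1 tendsto_natCast_atTop_atTop)
  have hlim : ∀ c : ℝ, Tendsto (fun k : ℕ => γ + c / Real.log ((k : ℝ) + 1)) atTop (𝓝 γ) :=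
    fun c => by simpa using (hlog.const_div_atTop c).const_add γ
  have hc₂ : 0 < c₂ := by
    have := (h₁ 0).trans (h₂ 0)
    simp only [Nat.cast_zero, zero_add, Real.one_rpow, mul_one] at this
    linarith
  have heq : ∀ c : ℝ, 0 < c → ∀ k : ℕ, 0 < Real.log ((k : ℝ) + 1) →
      Real.log (c * ((k : ℝ) + 1) ^ γ) / Real.log ((k : ℝ) + 1) =
        γ + Real.log c / Real.log ((k : ℝ) + 1) := by
    intro c hc k hk
    rw [Real.log_mul hc.ne' (by positivity), Real.log_rpow (by positivity)]
    field_simp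
    ring
  refine tendsto_of_tendsto_of_tendsto_of_le_of_le' (hlim (Real.log c₁)) (hlim (Real.log c₂)) ?_ ?_
  · filter_upwards [hlog.eventually_gt_atTop 0] with k hk
    rw [← heq c₁ hc₁ k hk]
    exact div_le_div_of_nonneg_right (Real.log_le_log (by positivity) (h₁ k)) hk.le
  · filter_upwards [hlog.eventually_gt_atTop 0] with k hk
    rw [← heq c₂ hc₂ k hk]
    refine div_le_div_of_nonneg_right (Real.log_le_log ?_ (h₂ k)) hk.le
    exact lt_of_lt_of_le (by positivity) (h₁ k)

theorem lowerRate_eq_of_rpow_bounds {m : ℕ} (t : Fin (m + 1) → ℝ) {a : ℕ → ℕ+} (ha : Monotone a)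
    {γ c₁ c₂ : ℝ} (hγ : 0 ≤ γ) (hc₁ : 0 < c₁)
    (h₁ : ∀ k : ℕ, c₁ * ((k : ℝ) + 1) ^ γ ≤ ((a k : ℕ) : ℝ))
    (h₂ : ∀ k : ℕ, ((a k : ℕ) : ℝ) ≤ c₂ * ((k : ℝ) + 1) ^ γ) :
    lowerRate t a = (((∑ i, t i) * γ : ℝ) : EReal) := by
  have hc₂ : 0 < c₂ := by
    have := (h₁ 0).trans (h₂ 0)
    simp only [Nat.cast_zero, zero_add, Real.one_rpow, mul_one] at this
    linarith
  have hi : ∀ i : ℕ, Tendsto (fun k : ℕ => Real.log ((a (k + i) : ℕ) : ℝ) /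
      Real.log ((k : ℝ) + 1)) atTop (𝓝 γ) := by
    intro i
    -- A shift by `i` only changes constants, since `k + i + 1 ≤ (i + 1) (k + 1)`.
    refine tendsto_log_div_log hc₁ (c₂ := c₂ * ((i : ℝ) + 1) ^ γ) (fun k => (h₁ k).trans ?_)
      fun k => (h₂ _).trans ?_
    · exact_mod_cast (ha (Nat.le_add_right k i) : a k ≤ a (k + i))
    · rw [mul_assoc, ← Real.mul_rpow (by positivity) (by positivity)]
      have hle : (((k + i : ℕ) : ℝ) + 1) ≤ ((i : ℝ) + 1) * ((k : ℝ) + 1) := by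
        have : (0 : ℝ) ≤ (i : ℝ) * k := by positivity
        push_cast
        linarith
      gcongr
  refine Tendsto.liminf_eq ((continuous_coe_real_ereal.tendsto _).comp ?_)
  have hsum := tendsto_finsetSum (Finset.univ : Finset (Fin (m + 1)))
    fun i _ => (hi (i : ℕ)).const_mul (t i)
  rw [← Finset.sum_mul] at hsum
  refine hsum.congr fun k => ?_
  rw [log_prod_rpow, Finset.sum_div]
  exact Finset.sum_congr rfl fun i _ => (mul_div_assoc _ _ _).symm

theorem lowerRate_eq_top_of_two_pow_le {m : ℕ} {t : Fin (m + 1) → ℝ} (ht : ∀ i, 0 ≤ t i)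
    (ht0 : t 0 ≠ 0) {a : ℕ → ℕ+} (h : ∀ k, 2 ^ (k + 1) ≤ (a k : ℕ)) : lowerRate t a = ⊤ := by
  have ht0' : 0 < t 0 := lt_of_le_of_ne (ht 0) ht0.symm
  have hl2 : 0 < Real.log 2 := Real.log_pos (by norm_num)
  refine Tendsto.liminf_eq (EReal.tendsto_coe_nhds_top_iff.2 ?_)
  have hlim : Tendsto (fun k : ℕ => t 0 * Real.log 2 / 2 * ((k : ℝ) + 1) ^ (1 / 2 : ℝ))
      atTop atTop :=
    ((tendsto_rpow_atTop (by norm_num)).comp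
      (tendsto_atTop_add_const_right _ 1 tendsto_natCast_atTop_atTop)).const_mul_atTop
        (by positivity)
  refine tendsto_atTop_mono' _ ?_ hlim
  filter_upwards [eventually_ge_atTop 1] with k hk
  have hk1 : (1 : ℝ) ≤ k := by exact_mod_cast hk
  have hlog : 0 < Real.log ((k : ℝ) + 1) := Real.log_pos (by linarith)
  rw [le_div_iff₀ hlog, log_prod_rpow]
  have h1 : t 0 * Real.log ((a k : ℕ) : ℝ) ≤
      ∑ i : Fin (m + 1), t i * Real.log ((a (k + (i : ℕ)) : ℕ) : ℝ) :=
    Finset.single_le_sum (f := fun i : Fin (m + 1) => t i * Real.log ((a (k + (i : ℕ)) : ℕ) : ℝ))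
      (fun i _ => mul_nonneg (ht i) (log_natCast_pnat_nonneg _)) (Finset.mem_univ 0)
  have h2 : ((k : ℝ) + 1) * Real.log 2 ≤ Real.log ((a k : ℕ) : ℝ) := by
    have h3 : ((2 : ℝ) ^ (k + 1)) ≤ ((a k : ℕ) : ℝ) := by exact_mod_cast h k
    have h4 := Real.log_le_log (by positivity) h3
    rwa [Real.log_pow, Nat.cast_succ] at h4
  -- A crude `log y ≤ 2 √y` suffices: the quotient is then at least a multiple of `√(k + 1)`.
  have h5 : Real.log ((k : ℝ) + 1) ≤ ((k : ℝ) + 1) ^ (1 / 2 : ℝ) / (1 / 2) :=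
    Real.log_le_rpow_div (by positivity) (by norm_num)
  have h6 : ((k : ℝ) + 1) ^ (1 / 2 : ℝ) * ((k : ℝ) + 1) ^ (1 / 2 : ℝ) = (k : ℝ) + 1 := by
    rw [← Real.rpow_add (by positivity)]
    norm_num
  calc t 0 * Real.log 2 / 2 * ((k : ℝ) + 1) ^ (1 / 2 : ℝ) * Real.log ((k : ℝ) + 1)
      ≤ t 0 * Real.log 2 / 2 * ((k : ℝ) + 1) ^ (1 / 2 : ℝ) *
          (((k : ℝ) + 1) ^ (1 / 2 : ℝ) / (1 / 2)) := mul_le_mul_of_nonneg_left h5 (by positivity)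
    _ = t 0 * (((k : ℝ) + 1) ^ (1 / 2 : ℝ) * ((k : ℝ) + 1) ^ (1 / 2 : ℝ) * Real.log 2) := by ring
    _ = t 0 * (((k : ℝ) + 1) * Real.log 2) := by rw [h6]
    _ ≤ t 0 * Real.log ((a k : ℕ) : ℝ) := mul_le_mul_of_nonneg_left h2 ht0'.le
    _ ≤ _ := h1

theorem exists_isDigitSeq_of_mem_levelSet {m : ℕ} {t : Fin (m + 1) → ℝ} {α : EReal} {x : ℝ}
    (hx : x ∈ levelSet f t α) :
    ∃ a, IsDigitSeq f a x ∧ Monotone a ∧ lowerRate t a = α := by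
  obtain ⟨⟨-, a, ha, hmono⟩, b, hb, hrate⟩ := hx
  obtain rfl := ha.2 b hb.1
  exact ⟨b, ha, monotone_nat_of_le_succ hmono, hrate⟩

theorem mem_levelSet_of_isDigitSeq {m : ℕ} {t : Fin (m + 1) → ℝ} {α : EReal} {x : ℝ}
    (hx : x ∈ Lam f) {a : ℕ → ℕ+} (ha : IsDigitSeq f a x)
    (h : Monotone a → lowerRate t a = α) : x ∈ levelSet f t α := by
  refine ⟨hx, a, ha, h ?_⟩
  obtain ⟨-, b, hb, hmono⟩ := hx
  obtain rfl := ha.2 b hb.1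
  exact monotone_nat_of_le_succ hmono

theorem le_ofReal_of_forall_gt {X : ENNReal} {s₀ : ℝ} (h : ∀ s, s₀ < s → X ≤ ENNReal.ofReal s) :
    X ≤ ENNReal.ofReal s₀ :=
  ge_of_tendsto ((ENNReal.continuous_ofReal.tendsto s₀).mono_left nhdsWithin_le_nhds)
    (eventually_mem_nhdsWithin (s := Ioi s₀) |>.mono h)

theorem ofReal_le_of_forall_lt {X : ENNReal} {s₀ : ℝ}
    (h : ∀ s, 0 < s → s < s₀ → ENNReal.ofReal s ≤ X) : ENNReal.ofReal s₀ ≤ X := by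
  refine le_of_tendsto ((ENNReal.continuous_ofReal.tendsto s₀).mono_left nhdsWithin_le_nhds)
    (eventually_mem_nhdsWithin (s := Iio s₀) |>.mono fun s hs => ?_)
  rcases le_or_gt s 0 with h0 | h0
  · simp [ENNReal.ofReal_of_nonpos h0]
  · exact h s h0 hs

/-! ### Dimension bounds for the level sets. -/

namespace IsDecayingGaussLike

theorem dimH_levelSet_le (hf : IsDecayingGaussLike d f) {m : ℕ} {t : Fin (m + 1) → ℝ}
    (ht : ∀ i, 0 ≤ t i) (hT : 0 < ∑ i, t i) {α s : ℝ} (hα : 0 ≤ α) (hs : 0 < s)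
    (h : (1 - s * d) * α < ∑ i, t i) :
    dimH (levelSet f t (α : EReal)) ≤ ENNReal.ofReal s := by
  set T := ∑ i, t i
  obtain ⟨x, hαx, hx⟩ : ∃ x, α < x ∧ (1 - s * d) * x < T := by
    have h1 : Tendsto (fun x : ℝ => (1 - s * d) * x) (𝓝[>] α) (𝓝 ((1 - s * d) * α)) :=
      (Continuous.tendsto (by fun_prop) α).mono_left nhdsWithin_le_nhds
    exact ((eventually_mem_nhdsWithin (s := Ioi α)).and (h1.eventually_lt_const h)).exists
  have hx0 : 0 < x := hα.trans_lt hαx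
  -- Here `1 - s d < e` makes the letter sum converge and `e < T / x` makes `β = (x / T) e` less
  -- than one.
  obtain ⟨e, he, he'⟩ := exists_between (max_lt (div_pos hT hx0) ((lt_div_iff₀ hx0).2 hx))
  have he0 : 0 < e := (le_max_left _ _).trans_lt he
  have hβ : x / T * e < 1 := by
    rw [lt_div_iff₀ hx0] at he'
    rw [div_mul_eq_mul_div, div_lt_one hT]
    linarith
  refine (dimH_mono fun z hz => ?_).trans
    (hf.dimH_le_of_frequently he0.le hβ hs (by linarith [le_max_right 0 (1 - s * d)]))
  obtain ⟨a, ha, hmono, hrate⟩ := exists_isDigitSeq_of_mem_levelSet hz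
  refine ⟨a, ha.1, hmono, ?_⟩
  refine (frequently_le_rpow_of_lowerRate_lt ht hT hmono (x := x) ?_).mono fun k hk => ?_
  · rw [hrate]
    exact_mod_cast hαx
  · rw [Real.rpow_mul (by positivity)]
    exact Real.rpow_le_rpow (by positivity) hk he0.le

theorem dimH_Lam_le (hf : IsDecayingGaussLike d f) : dimH (Lam f) ≤ ENNReal.ofReal (1 / d) := by
  have hd : 0 < d := one_pos.trans hf.one_lt
  refine le_ofReal_of_forall_gt fun s hs => ?_
  rw [div_lt_iff₀ hd] at hs
  have hs0 : 0 < s := by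
    by_contra! h0
    nlinarith
  refine (dimH_mono fun z hz => ?_).trans
    (hf.dimH_le_of_frequently (e := 0) (β := 0) le_rfl one_pos hs0 (by linarith))
  obtain ⟨-, a, ha, hmono⟩ := hz
  exact ⟨a, ha.1, monotone_nat_of_le_succ hmono, Frequently.of_forall fun k => by simp⟩

theorem le_dimH_levelSet_top (hf : IsDecayingGaussLike d f) {m : ℕ} {t : Fin (m + 1) → ℝ}
    (ht : ∀ i, 0 ≤ t i) (ht0 : t 0 ≠ 0) :
    ENNReal.ofReal (1 / d) ≤ dimH (levelSet f t ⊤) := by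
  have hd : 0 < d := one_pos.trans hf.one_lt
  refine ofReal_le_of_forall_lt fun s hs hsd => ?_
  have hds : d < 1 / s := by
    rw [lt_div_iff₀ hd] at hsd
    rw [lt_div_iff₀ hs]
    linarith
  obtain ⟨D, hdD, hDs⟩ := exists_between hds
  rw [lt_div_iff₀ hs] at hDs
  refine (hf.le_dimH_of_digit_blocks hs hdD (B := fun k => 2 ^ (k + 2)) (q := fun k => 2 ^ (k + 1))
    (fun k => Nat.le_self_pow (by omega) 2) (fun k => by positivity) (fun k => ?_) ?_).trans
    (dimH_mono ?_)
  · simp only [pow_succ]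
    omega
  · intro C hC
    have h1 : Tendsto (fun k : ℕ => (2 : ℝ) ^ ((1 - D * s) * k)) atTop atTop :=
      (tendsto_rpow_atTop_of_base_gt_one 2 (by norm_num)).comp
        (tendsto_natCast_atTop_atTop.const_mul_atTop (by linarith))
    filter_upwards [h1.eventually_ge_atTop (C * 2 ^ (4 * (D * s) - 1))] with k hk
    have h2 : ((2 ^ (k + 1 + 2) + 2 * 2 ^ (k + 1 + 1) : ℕ) : ℝ) = (2 : ℝ) ^ ((k : ℝ) + 4) := by
      rw [show (k : ℝ) + 4 = ((k + 4 : ℕ) : ℝ) by push_cast; ring, Real.rpow_natCast]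
      push_cast
      ring
    have h3 : ((2 ^ (k + 1) : ℕ) : ℝ) = (2 : ℝ) ^ ((k : ℝ) + 1) := by
      rw [show (k : ℝ) + 1 = ((k + 1 : ℕ) : ℝ) by push_cast; ring, Real.rpow_natCast]
      push_cast
      ring
    rw [h2, h3, ← Real.rpow_mul (by norm_num)]
    have h4 : (2 : ℝ) ^ (((k : ℝ) + 4) * (D * s)) =
        2 ^ (4 * (D * s) - 1) * 2 ^ ((k : ℝ) * (D * s) + 1) := by
      rw [← Real.rpow_add (by norm_num)]
      ring_nf
    have h5 : (2 : ℝ) ^ ((k : ℝ) + 1) =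
        2 ^ ((1 - D * s) * k) * 2 ^ ((k : ℝ) * (D * s) + 1) := by
      rw [← Real.rpow_add (by norm_num)]
      ring_nf
    rw [h4, h5, ← mul_assoc]
    exact mul_le_mul_of_nonneg_right hk (by positivity)
  · rintro x ⟨hx, a, ha, hBa⟩
    refine mem_levelSet_of_isDigitSeq hx ha fun _ => lowerRate_eq_top_of_two_pow_le ht ht0 fun k => ?_
    exact (Nat.pow_le_pow_right (by norm_num) (by omega)).trans (hBa k).1

theorem le_dimH_levelSet (hf : IsDecayingGaussLike d f) {m : ℕ} {t : Fin (m + 1) → ℝ} {γ s : ℝ}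
    (hγ : 1 ≤ γ) (hs : 0 < s) (h : γ * (d * s) < γ - 1) :
    ENNReal.ofReal s ≤ dimH (levelSet f t (((∑ i, t i) * γ : ℝ) : EReal)) := by
  have hγ0 : 0 < γ := by linarith
  have hds : d < (γ - 1) / (γ * s) := by
    rw [lt_div_iff₀ (by positivity)]
    linarith
  obtain ⟨D, hdD, hDs⟩ := exists_between hds
  rw [lt_div_iff₀ (by positivity)] at hDs
  have hD0 : 0 < D := (one_pos.trans hf.one_lt).trans hdD
  -- The factor `2` makes the gap between successive `B k` large enough for `2 * q k`.
  set B : ℕ → ℕ := fun k => ⌈2 * ((k : ℝ) + 1) ^ γ⌉₊ with hB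
  set q : ℕ → ℕ := fun k => ⌊((k : ℝ) + 1) ^ (γ - 1)⌋₊ with hq
  have hone : ∀ (k : ℕ) {r : ℝ}, 0 ≤ r → 1 ≤ ((k : ℝ) + 1) ^ r := fun k r hr =>
    Real.one_le_rpow (by linarith [Nat.cast_nonneg (α := ℝ) k]) hr
  have hBlow : ∀ k : ℕ, 2 * ((k : ℝ) + 1) ^ γ ≤ B k := fun k => Nat.le_ceil _
  have hBup : ∀ k : ℕ, (B k : ℝ) < 2 * ((k : ℝ) + 1) ^ γ + 1 := fun k =>
    Nat.ceil_lt_add_one (by positivity)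
  have hqup : ∀ k : ℕ, (q k : ℝ) ≤ ((k : ℝ) + 1) ^ (γ - 1) := fun k =>
    Nat.floor_le (by positivity)
  have hq1 : ∀ k : ℕ, 1 ≤ q k := fun k => Nat.one_le_floor_iff _ |>.2 (hone k (by linarith))
  have hqlow : ∀ k : ℕ, ((k : ℝ) + 1) ^ (γ - 1) / 2 ≤ q k := fun k => by
    have h1 := Nat.lt_floor_add_one (((k : ℝ) + 1) ^ (γ - 1))
    have h2 : (1 : ℝ) ≤ q k := by exact_mod_cast hq1 k
    have h3 : ((k : ℝ) + 1) ^ (γ - 1) < q k + 1 := h1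
    linarith
  have hmul : ∀ k : ℕ, ((k : ℝ) + 1) ^ γ = ((k : ℝ) + 1) * ((k : ℝ) + 1) ^ (γ - 1) := fun k => by
    rw [Real.rpow_sub_one (by positivity)]
    field_simp
  have hA : ∀ k : ℕ, ((B k + 2 * q k : ℕ) : ℝ) ≤ 5 * ((k : ℝ) + 1) ^ γ := fun k => by
    have h1 : ((k : ℝ) + 1) ^ (γ - 1) ≤ ((k : ℝ) + 1) ^ γ :=
      Real.rpow_le_rpow_of_exponent_le (by linarith [Nat.cast_nonneg (α := ℝ) k]) (by linarith)
    push_cast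
    linarith [hBup k, hqup k, hone k hγ0.le]
  refine (hf.le_dimH_of_digit_blocks hs hdD (B := B) (q := q) (fun k => ?_) hq1 (fun k => ?_)
    ?_).trans (dimH_mono ?_)
  · have h1 : (2 : ℝ) ≤ B k := by linarith [hBlow k, hone k hγ0.le]
    exact_mod_cast h1
  · have h1 : ((k : ℝ) + 1) ^ (γ - 1) ≤ (((k + 1 : ℕ) : ℝ) + 1) ^ (γ - 1) := by
      refine Real.rpow_le_rpow (by positivity) ?_ (by linarith)
      push_cast
      linarith
    have h2 := mul_le_mul_of_nonneg_left h1 (by positivity : (0 : ℝ) ≤ ((k + 1 : ℕ) : ℝ) + 1)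
    rw [← hmul] at h2
    -- Uses `(k+1)^γ + (k+1)^(γ-1) = (k+2) (k+1)^(γ-1) ≤ (k+2)^γ`; the slack `2` absorbs the
    -- rounding up in `B k`.
    have h3 : (B k : ℝ) + 2 * q k < B (k + 1) + 2 := by
      have h4 := hmul k
      have h5 := hBlow (k + 1)
      rw [Nat.cast_succ, add_mul, one_mul, ← hmul] at h2
      push_cast at h2 h5
      linarith [hBup k, hqup k]
    exact_mod_cast h3.le
  · intro C hC
    set H : ℝ := (5 * 2 ^ γ) ^ (D * s) with hH
    have h1 : Tendsto (fun k : ℕ => ((k : ℝ) + 1) ^ (γ - 1 - γ * (D * s))) atTop atTop :=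
      (tendsto_rpow_atTop (by linarith)).comp
        (tendsto_atTop_add_const_right _ 1 tendsto_natCast_atTop_atTop)
    filter_upwards [h1.eventually_ge_atTop (2 * (C * H))] with k hk
    have h2 : ((B (k + 1) + 2 * q (k + 1) : ℕ) : ℝ) ≤ 5 * 2 ^ γ * ((k : ℝ) + 1) ^ γ := by
      refine (hA (k + 1)).trans ?_
      rw [mul_assoc, ← Real.mul_rpow (by norm_num) (by positivity)]
      have h3 : (((k + 1 : ℕ) : ℝ) + 1) ≤ 2 * ((k : ℝ) + 1) := by
        push_cast
        linarith [Nat.cast_nonneg (α := ℝ) k]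
      gcongr
    have h3 : ((B (k + 1) + 2 * q (k + 1) : ℕ) : ℝ) ^ (D * s) ≤
        H * ((k : ℝ) + 1) ^ (γ * (D * s)) := by
      rw [Real.rpow_mul (x := (k : ℝ) + 1) (by positivity), hH,
        ← Real.mul_rpow (by positivity) (by positivity)]
      exact Real.rpow_le_rpow (by positivity) h2 (by positivity)
    have h4 : ((k : ℝ) + 1) ^ (γ - 1) =
        ((k : ℝ) + 1) ^ (γ - 1 - γ * (D * s)) * ((k : ℝ) + 1) ^ (γ * (D * s)) := by
      rw [← Real.rpow_add (by positivity)]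
      ring_nf
    have h5 := mul_le_mul_of_nonneg_right hk
      (by positivity : (0 : ℝ) ≤ ((k : ℝ) + 1) ^ (γ * (D * s)))
    rw [← h4] at h5
    linarith [hqlow k, mul_le_mul_of_nonneg_left h3 hC.le]
  · rintro x ⟨hx, a, ha, hBa⟩
    refine mem_levelSet_of_isDigitSeq hx ha fun hmono =>
      lowerRate_eq_of_rpow_bounds t hmono hγ0.le two_pos (c₂ := 5) (fun k => ?_) fun k => ?_
    · exact (hBlow k).trans (by exact_mod_cast (hBa k).1)
    · exact le_trans (by exact_mod_cast (hBa k).2) (hA k)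

end IsDecayingGaussLike

end GaussLike

end

theorem theorem1p4 (d : ℝ) (f : ℕ+ → ℝ → ℝ) (hf : GaussLike.IsDecayingGaussLike d f)
    (m : ℕ) (hm : 1 ≤ m) (t : Fin (m + 1) → ℝ) (ht : ∀ i, 0 ≤ t i) (ht0 : t 0 ≠ 0)
    (ht1 : ∃ i, i ≠ 0 ∧ t i ≠ 0) :
    (∀ α : ℝ, 0 ≤ α → α < ∑ i, t i →
      dimH (GaussLike.levelSet f t (α : EReal)) = 0) ∧
    (∀ α : ℝ, ∑ i, t i ≤ α →
      dimH (GaussLike.levelSet f t (α : EReal)) =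
        ENNReal.ofReal ((α - ∑ i, t i) / (d * α))) ∧
    dimH (GaussLike.levelSet f t ⊤) = ENNReal.ofReal (1 / d) := by
  have hd : 0 < d := one_pos.trans hf.one_lt
  have hT : 0 < ∑ i, t i :=
    Finset.sum_pos' (fun i _ => ht i) ⟨0, Finset.mem_univ 0, lt_of_le_of_ne (ht 0) ht0.symm⟩
  refine ⟨fun α hα hαT => ?_, fun α hα => le_antisymm ?_ ?_, le_antisymm ?_ ?_⟩
  · rw [← nonpos_iff_eq_zero, ← ENNReal.ofReal_zero]
    refine GaussLike.le_ofReal_of_forall_gt fun s hs => hf.dimH_levelSet_le ht hT hα hs ?_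
    have : 0 ≤ s * d * α := by positivity
    linarith
  · have hα0 : 0 < α := hT.trans_le hα
    refine GaussLike.le_ofReal_of_forall_gt fun s hs => hf.dimH_levelSet_le ht hT hα0.le ?_ ?_
    · exact (div_nonneg (sub_nonneg.2 hα) (by positivity)).trans_lt hs
    · rw [div_lt_iff₀ (by positivity)] at hs
      linarith
  · have hα0 : 0 < α := hT.trans_le hα
    refine GaussLike.ofReal_le_of_forall_lt fun s hs hs' => ?_
    have h := hf.le_dimH_levelSet (t := t) (γ := α / ∑ i, t i) ((one_le_div hT).2 hα) hs ?_
    · rwa [mul_div_cancel₀ _ hT.ne'] at h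
    · rw [lt_div_iff₀ (by positivity)] at hs'
      rw [div_mul_eq_mul_div, div_sub_one hT.ne', div_lt_div_iff_of_pos_right hT]
      linarith
  · exact (dimH_mono fun x hx => hx.1).trans hf.dimH_Lam_le
  · exact hf.le_dimH_levelSet_top ht ht0
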